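/- All graphs are finite and simple, and are considered up to isomorphism. Let $G$ be a graph and let $f\colon E(G)\to E(G)$ be a mapping with $f(e)\neq e$ for all $e\in E(G)$. A subgraph $H$ of $G$ is called $f$-free if $f(e)\notin E(H)$ for all $e\in E(H)$. A graph $G$ is unavoidable for a graph $F$ if $G$ contains a subgraph isomorphic to $F$ and, for every mapping $f\colon E(G)\to E(G)$ with $f(e)\ne e$ for all $e\in E(G)$, some subgraph of $G$ isomorphic to $F$ is $f$-free. It is minimal unavoidable for $F$ if moreover no proper subgraph of $G$ is unavoidable for $F$. Let $\mathcal{M}(F)$ denote the set of (isomorphism classes of) minimal unavoidable graphs for $F$, and for $t\ge 0$ let $tK_2$ be the vertex-disjoint union of $t$ copies of $K_2$. Theorem. If $F$ is a forest without isolated vertices, then $\mathcal{M}(F)$ is finite if and only if $F\cong tK_2$ for some $t\ge 0$. More generally, for every forest $F$, $\mathcal{M}(F)$ is finite if and only if the graph obtained from $F$ by deleting its isolated vertices is isomorphic to $tK_2$ for some $t\ge 0$. -/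

import Mathlib

namespace EdgeMapping

open SimpleGraph

/-- A subgraph `H` of `G` is `f`-free, for an edge mapping `f : E(G) → E(G)`, if `f e ∉ E(H)` for
every edge `e ∈ E(H)`. -/
def IsFree {V : Type*} {G : SimpleGraph V} (f : G.edgeSet → G.edgeSet) (H : G.Subgraph) : Prop :=
  ∀ e : G.edgeSet, (e : Sym2 V) ∈ H.edgeSet → (f e : Sym2 V) ∉ H.edgeSet

/-- `G` is unavoidable for `F` if `G` contains a copy of `F` and, for every edge mapping
`f : E(G) → E(G)` with `f e ≠ e` for all `e` (equivalently `|f e ∩ e| ≤ 1`), there is an `f`-free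
copy of `F` in `G`.

The first clause follows from the second as soon as a mapping without fixed edges exists, that is,
whenever `G` does not have exactly one edge. It only prevents a graph with a single edge (which has
no such mapping) from being vacuously unavoidable for every graph. -/
def Unavoidable {V W : Type*} (G : SimpleGraph V) (F : SimpleGraph W) : Prop :=
  F.IsContained G ∧
    ∀ f : G.edgeSet → G.edgeSet, (∀ e, f e ≠ e) →
      ∃ H : G.Subgraph, Nonempty (F ≃g H.coe) ∧ IsFree f H

/-- `G` is minimal unavoidable for `F`: it is unavoidable for `F`, and no proper subgraph (obtained
by deleting edges and/or vertices) is unavoidable for `F`. -/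
def MinimalUnavoidable {V W : Type*} (G : SimpleGraph V) (F : SimpleGraph W) : Prop :=
  Unavoidable G F ∧ ∀ H : G.Subgraph, H ≠ ⊤ → ¬ Unavoidable H.coe F

/-- Isomorphism of finite graphs; every finite graph is isomorphic to one on some `Fin n`. -/
instance finiteGraphSetoid : Setoid (Σ n : ℕ, SimpleGraph (Fin n)) where
  r G H := Nonempty (G.2 ≃g H.2)
  iseqv :=
    { refl := fun _ => ⟨Iso.refl⟩
      symm := fun ⟨e⟩ => ⟨e.symm⟩
      trans := fun ⟨e⟩ ⟨e'⟩ => ⟨e.trans e'⟩ }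

/-- Isomorphism classes of finite graphs. -/
abbrev FiniteGraphClass : Type := Quotient finiteGraphSetoid

/-- The set `𝓜(F)` of (isomorphism classes of) finite minimal unavoidable graphs for `F`. -/
def minimalUnavoidableGraphs {W : Type*} (F : SimpleGraph W) : Set FiniteGraphClass :=
  {c | ∃ G : Σ n : ℕ, SimpleGraph (Fin n), ⟦G⟧ = c ∧ MinimalUnavoidable G.2 F}

/-- The matching `t K₂`: the vertex-disjoint union of `t` copies of `K₂`. -/
def matchingGraph (t : ℕ) : SimpleGraph (Fin t × Fin 2) where
  Adj x y := x.1 = y.1 ∧ x.2 ≠ y.2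
  symm := ⟨fun _ _ h => ⟨h.1.symm, h.2.symm⟩⟩
  loopless := ⟨fun _ h => h.2 rfl⟩

end EdgeMapping

namespace EdgeMapping

open SimpleGraph

/-! A forest is, up to isolated vertices, a matching, or a star forest with a vertex of degree at
least 2, or it contains a path with three edges. The first case is finite, the other two are
infinite.

Matching. The digraph of a self-map has an independent third, so `3t` disjoint edges always contain
`t` that form a free copy. A large minimal graph therefore has no matching of size `3t` (otherwise a
vertex off the matching could be deleted) and has a cover by `6t` vertices. Graphs with a cover of
fixed size are well-quasi-ordered by containment (Dickson's lemma), and minimal graphs form an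
antichain.

For the infinite cases it suffices to find, for every `N`, an unavoidable graph without an
unavoidable subgraph on at most `N` vertices.

Path with three edges. Dense graphs are unavoidable, since an independent third of the edges is
still dense enough to contain the forest, while mapping each edge to the next one towards a root
shows that acyclic graphs are avoidable. Graphs with many edges and locally acyclic structure
combine both (`exists_locally_acyclic`).

Star forest of maximum degree `s + 2`. Take many disjoint suns: long cycles with `3s` pendant edges
at every cycle vertex and one more pendant edge in all. By `exists_independent_subset` and a count
that is tight up to that one edge, every sun has a free star with `s + 2` edges. Once a cycle vertex
is missing, the edges at each remaining one split into `s + 1` groups in which any two are related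
by one map (`sunStep`), so no free star of that size is left. -/

/-! ### Labelled copies and monotonicity. -/

/-- Unavoidability in terms of labelled copies and arbitrary self-maps of the set of pairs: fixed
pairs impose no condition. -/
theorem unavoidable_iff {V W : Type*} {G : SimpleGraph V} {F : SimpleGraph W} :
    Unavoidable G F ↔ ∀ g : Sym2 V → Sym2 V, ∃ φ : Copy F G, ∀ e ∈ F.edgeSet, ∀ e' ∈ F.edgeSet,
      e ≠ e' → g (e.map φ) ≠ e'.map φ := by
  classical
  constructor
  · rintro ⟨⟨φ₀⟩, h⟩ g
    by_cases hE : ∀ e ∈ F.edgeSet, ∀ e' ∈ F.edgeSet, e = e'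
    · exact ⟨φ₀, fun e he e' he' hne => absurd (hE e he e' he') hne⟩
    push Not at hE
    obtain ⟨a, ha, b, hb, hab⟩ := hE
    -- Two edges of a copy of `F` provide a different edge for every edge of `G`: the default value
    -- where `g` fixes an edge or leaves the edge set.
    have hne : ∀ e : G.edgeSet, ∃ e' : G.edgeSet, e' ≠ e := by
      intro e
      by_cases h1 : φ₀.mapEdgeSet ⟨a, ha⟩ = e
      · refine ⟨φ₀.mapEdgeSet ⟨b, hb⟩, fun h2 => hab ?_⟩
        have := φ₀.mapEdgeSet.injective (h1.trans h2.symm)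
        simpa using this
      · exact ⟨_, h1⟩
    choose o ho using hne
    let f : G.edgeSet → G.edgeSet := fun e =>
      if hg : g e ∈ G.edgeSet ∧ g e ≠ e then ⟨g e, hg.1⟩ else o e
    have hf : ∀ e, f e ≠ e := by
      intro e
      by_cases hg : g e ∈ G.edgeSet ∧ g e ≠ e
      · simp only [f, dif_pos hg]
        exact fun h => hg.2 (congrArg Subtype.val h)
      · simp only [f, dif_neg hg]
        exact ho e
    obtain ⟨H, ⟨i⟩, hH⟩ := h f hf
    refine ⟨H.coeCopy.comp i.toCopy, fun e he e' he' hee hg => ?_⟩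
    set ψ := H.coeCopy.comp i.toCopy with hψ
    have hmem : ∀ x ∈ F.edgeSet, x.map ψ ∈ H.edgeSet := by
      intro x
      induction x using Sym2.ind with
      | _ u v =>
        intro hx
        exact i.map_adj_iff.2 hx
    have hinj : Function.Injective (Sym2.map ψ) := Sym2.map.injective ψ.injective
    have h1 := H.edgeSet_subset (hmem e he)
    have h2 := H.edgeSet_subset (hmem e' he')
    refine hH ⟨_, h1⟩ (hmem e he) ?_
    have hc : g (e.map ψ) ∈ G.edgeSet ∧ g (e.map ψ) ≠ e.map ψ := by
      rw [hg]
      exact ⟨h2, fun h => hee (hinj h).symm⟩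
    simp only [f, dif_pos hc]
    rw [hg]
    exact hmem e' he'
  · intro h
    refine ⟨⟨(h id).choose⟩, fun f hf => ?_⟩
    obtain ⟨φ, hφ⟩ := h fun e => if he : e ∈ G.edgeSet then (f ⟨e, he⟩ : Sym2 V) else e
    refine ⟨φ.toSubgraph, ⟨φ.isoToSubgraph⟩, fun e he hfe => ?_⟩
    have key : ∀ x ∈ φ.toSubgraph.edgeSet, ∃ y ∈ F.edgeSet, y.map φ = x := by
      intro x hx
      rw [Subgraph.edgeSet_map] at hx
      simpa using hx
    obtain ⟨x, hx, hxe⟩ := key _ he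
    obtain ⟨y, hy, hye⟩ := key _ hfe
    by_cases hxy : x = y
    · subst hxy
      exact hf e (Subtype.ext (hye.symm.trans hxe))
    · refine hφ x hx y hy hxy ?_
      rw [hxe, dif_pos e.2, hye]

/-- An unavoidable subgraph provides, for every self-map of the pairs of the large graph, a free copy
inside the subgraph. -/
theorem Unavoidable.exists_copy {U V W : Type*} {K : SimpleGraph U} {G : SimpleGraph V}
    {F : SimpleGraph W} (h : Unavoidable K F) (ψ : Copy K G) (g : Sym2 V → Sym2 V) :
    ∃ φ : Copy F K, ∀ e ∈ F.edgeSet, ∀ e' ∈ F.edgeSet, e ≠ e' →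
      g (e.map (ψ.comp φ)) ≠ e'.map (ψ.comp φ) := by
  classical
  have hinj : Function.Injective (Sym2.map ψ) := Sym2.map.injective ψ.injective
  -- The pullback of `g` along `ψ`. The default value never matters: a violated condition has its
  -- target in the image of `ψ`.
  obtain ⟨φ, hφ⟩ := unavoidable_iff.1 h
    fun e => if he : ∃ e', Sym2.map ψ e' = g (e.map ψ) then he.choose else e
  refine ⟨φ, fun e he e' he' hne hg => hφ e he e' he' hne ?_⟩
  have hc : ∃ e'', Sym2.map ψ e'' = g ((e.map φ).map ψ) := by
    refine ⟨e'.map φ, ?_⟩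
    simp only [Sym2.map_map]
    simpa using hg.symm
  rw [dif_pos hc]
  refine hinj (hc.choose_spec.trans ?_)
  simp only [Sym2.map_map]
  simpa using hg

theorem Unavoidable.mono {U V W : Type*} {K : SimpleGraph U} {G : SimpleGraph V}
    {F : SimpleGraph W} (h : Unavoidable K F) (hKG : K ⊑ G) : Unavoidable G F := by
  obtain ⟨ψ⟩ := hKG
  refine unavoidable_iff.2 fun g => ?_
  obtain ⟨φ, hφ⟩ := h.exists_copy ψ g
  exact ⟨ψ.comp φ, hφ⟩

/-! ### Independent sets in digraphs of small out-degree. -/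

/-- A self-map of a finite set `A` with `m` arcs inside `A` has an independent set of size at least
`(2 |A| - m) / 3`. -/
theorem exists_independent_subset {α : Type*} [DecidableEq α] (g : α → α) (A : Finset α) :
    ∃ B ⊆ A, (∀ x ∈ B, ∀ y ∈ B, x ≠ y → g x ≠ y) ∧
      2 * A.card ≤ 3 * B.card + (A.filter fun x => g x ∈ A ∧ g x ≠ x).card := by
  induction A using Finset.strongInduction with
  | H A ih =>
  rcases A.eq_empty_or_nonempty with rfl | hA
  · exact ⟨∅, by simp⟩
  have hmono : ∀ A' ⊆ A, (A'.filter fun x => g x ∈ A' ∧ g x ≠ x) ⊆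
      A.filter fun x => g x ∈ A ∧ g x ≠ x := by
    intro A' hA' x hx
    simp only [Finset.mem_filter] at hx ⊢
    exact ⟨hA' hx.1, hA' hx.2.1, hx.2.2⟩
  by_cases h0 : ∃ x ∈ A, ∀ y ∈ A, y ≠ x → g y ≠ x
  · obtain ⟨x, hx, hin⟩ := h0
    by_cases hout : g x ∈ A ∧ g x ≠ x
    -- Putting `x` into `B` removes two points and at least one arc, and `2 * 2 ≤ 3 + 1`.
    · set A' := (A.erase x).erase (g x) with hA'
      have hsub : A' ⊆ A := (Finset.erase_subset _ _).trans (Finset.erase_subset _ _)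
      have hxA' : x ∉ A' := by simp [hA']
      have hgA' : g x ∉ A' := by simp [hA']
      obtain ⟨B, hB, hind, hcard⟩ := ih A' (Finset.ssubset_iff_subset_ne.2
        ⟨hsub, fun h => hxA' (h ▸ hx)⟩)
      have hxB : x ∉ B := fun h => hxA' (hB h)
      refine ⟨insert x B, Finset.insert_subset hx (hB.trans hsub), ?_, ?_⟩
      · intro y hy z hz hyz
        rw [Finset.mem_insert] at hy hz
        rcases hy with rfl | hy <;> rcases hz with rfl | hz
        · exact absurd rfl hyz
        · rintro rfl
          exact hgA' (hB hz)
        · exact hin y (hsub (hB hy)) hyz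
        · exact hind y hy z hz hyz
      · have h1 : A'.card = A.card - 1 - 1 := by
          rw [hA', Finset.card_erase_of_mem (Finset.mem_erase.2 ⟨hout.2, hout.1⟩),
            Finset.card_erase_of_mem hx]
        have h2 : (A'.filter fun x => g x ∈ A' ∧ g x ≠ x).card <
            (A.filter fun x => g x ∈ A ∧ g x ≠ x).card := by
          refine Finset.card_lt_card (Finset.ssubset_iff_subset_ne.2 ⟨hmono A' hsub, fun h => ?_⟩)
          have : x ∈ A.filter fun x => g x ∈ A ∧ g x ≠ x := by simp [hx, hout]
          rw [← h] at this
          exact hxA' (Finset.mem_filter.1 this).1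
        rw [Finset.card_insert_of_notMem hxB]
        omega
    · have hsub : A.erase x ⊆ A := Finset.erase_subset _ _
      obtain ⟨B, hB, hind, hcard⟩ := ih (A.erase x) (Finset.erase_ssubset hx)
      have hxB : x ∉ B := fun h => by simpa using hB h
      refine ⟨insert x B, Finset.insert_subset hx (hB.trans hsub), ?_, ?_⟩
      · intro y hy z hz hyz
        rw [Finset.mem_insert] at hy hz
        rcases hy with rfl | hy <;> rcases hz with rfl | hz
        · exact absurd rfl hyz
        · rintro rfl
          exact hout ⟨hsub (hB hz), hyz.symm⟩
        · exact hin y (hsub (hB hy)) hyz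
        · exact hind y hy z hz hyz
      · have h1 := Finset.card_erase_of_mem hx
        have h2 := Finset.card_le_card (hmono _ hsub)
        rw [Finset.card_insert_of_notMem hxB]
        omega
  -- Every point now has a predecessor other than itself, so `g` permutes `A` without fixed points
  -- and the number of arcs is `|A|`. It is enough to lose at most three points: `x`, its successor
  -- and its predecessor.
  · push Not at h0
    have himg : A ⊆ A.image g := by
      intro x hx
      obtain ⟨y, hy, -, hyx⟩ := h0 x hx
      exact Finset.mem_image.2 ⟨y, hy, hyx⟩
    have hAeq : A = A.image g := Finset.eq_of_subset_of_card_le himg Finset.card_image_le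
    have hinj : Set.InjOn g A := by
      rw [← Finset.card_image_iff, ← hAeq]
    have hmap : ∀ x ∈ A, g x ∈ A := fun x hx => by
      rw [hAeq]
      exact Finset.mem_image_of_mem g hx
    have hfix : ∀ x ∈ A, g x ≠ x := by
      intro x hx h
      obtain ⟨y, hy, hyx, hgy⟩ := h0 x hx
      exact hyx (hinj hy hx (hgy.trans h.symm))
    have hm : (A.filter fun x => g x ∈ A ∧ g x ≠ x) = A :=
      Finset.filter_true_of_mem fun x hx => ⟨hmap x hx, hfix x hx⟩
    obtain ⟨x, hx⟩ := hA
    obtain ⟨y, hy, hyx, hgy⟩ := h0 x hx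
    set R : Finset α := {x, g x, y} with hR
    have hRc : R.card ≤ 3 := Finset.card_le_three
    obtain ⟨B, hB, hind, hcard⟩ := ih (A \ R) (Finset.ssubset_iff_subset_ne.2
      ⟨Finset.sdiff_subset, fun h => by
        rw [← h] at hx
        simp [hR] at hx⟩)
    have hBR : ∀ z ∈ B, z ∉ R := fun z hz => (Finset.mem_sdiff.1 (hB hz)).2
    have hxB : x ∉ B := fun h => hBR x h (by simp [hR])
    refine ⟨insert x B, Finset.insert_subset hx (hB.trans Finset.sdiff_subset), ?_, ?_⟩
    · intro a ha b hb hab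
      rw [Finset.mem_insert] at ha hb
      rcases ha with rfl | ha <;> rcases hb with rfl | hb
      · exact absurd rfl hab
      · rintro rfl
        exact hBR _ hb (by simp [hR])
      · intro h
        have : a = y := hinj (Finset.sdiff_subset (hB ha)) hy (h.trans hgy.symm)
        exact hBR a ha (by simp [hR, this])
      · exact hind a ha b hb hab
    · have h1 : A.card ≤ (A \ R).card + R.card := Finset.card_le_card_sdiff_add_card
      have h2 : ((A \ R).filter fun x => g x ∈ A \ R ∧ g x ≠ x).card ≤ (A \ R).card :=
        Finset.card_filter_le _ _
      rw [hm, Finset.card_insert_of_notMem hxB]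
      omega

/-- A third of the points of a finite set is independent for a self-map. -/
theorem exists_independent_third {α : Type*} [DecidableEq α] (g : α → α) (A : Finset α) :
    ∃ B ⊆ A, (∀ x ∈ B, ∀ y ∈ B, x ≠ y → g x ≠ y) ∧ A.card ≤ 3 * B.card := by
  obtain ⟨B, hB, hind, hcard⟩ := exists_independent_subset g A
  have := A.card_filter_le fun x => g x ∈ A ∧ g x ≠ x
  exact ⟨B, hB, hind, by omega⟩

/-- In a relation with out-degrees at most `r`, a set of `(2 r + 1) m` points contains `m` pairwise
unrelated ones. -/
theorem exists_independent_of_outDegree_le {α : Type*} (R : α → α → Prop)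
    (r : ℕ) (A : Finset α) (hR : ∀ x ∈ A, ∃ S : Finset α, S.card ≤ r ∧ ∀ y ∈ A, R x y → y ∈ S)
    (m : ℕ) (hm : (2 * r + 1) * m ≤ A.card) :
    ∃ B ⊆ A, B.card = m ∧ ∀ x ∈ B, ∀ y ∈ B, x ≠ y → ¬ R x y := by
  classical
  induction m generalizing A with
  | zero => exact ⟨∅, by simp⟩
  | succ m ih =>
    have hdeg : ∀ x ∈ A, (A.filter fun y => R x y).card ≤ r := by
      intro x hx
      obtain ⟨S, hS, h⟩ := hR x hx
      refine (Finset.card_le_card fun y hy => ?_).trans hS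
      rw [Finset.mem_filter] at hy
      exact h y hy.1 hy.2
    -- In-degrees and out-degrees have the same sum, so some in-degree is at most `r`.
    obtain ⟨x, hx, hin⟩ : ∃ x ∈ A, (A.filter fun y => R y x).card ≤ r := by
      by_contra! hcon
      have h1 : ∑ x ∈ A, (A.filter fun y => R y x).card = ∑ x ∈ A, (A.filter fun y => R x y).card :=
        Finset.sum_card_bipartiteAbove_eq_sum_card_bipartiteBelow (fun x y => R y x)
      have h2 : ∑ x ∈ A, (A.filter fun y => R x y).card ≤ A.card * r :=
        Finset.sum_le_card_nsmul _ _ _ hdeg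
      have h3 : A.card * (r + 1) ≤ ∑ x ∈ A, (A.filter fun y => R y x).card :=
        Finset.card_nsmul_le_sum A _ (r + 1) hcon
      have h4 : 0 < A.card := by nlinarith
      nlinarith
    set Q := insert x ((A.filter fun y => R x y) ∪ A.filter fun y => R y x) with hQ
    have hQc : Q.card ≤ 2 * r + 1 := by
      have h1 := Finset.card_insert_le x ((A.filter fun y => R x y) ∪ A.filter fun y => R y x)
      have h2 := Finset.card_union_le (A.filter fun y => R x y) (A.filter fun y => R y x)
      have h3 := hdeg x hx
      rw [hQ]
      omega
    have h1 : A.card ≤ (A \ Q).card + Q.card := Finset.card_le_card_sdiff_add_card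
    obtain ⟨B, hB, hBm, hind⟩ := ih (A \ Q)
      (fun z hz => by
        obtain ⟨S, hS, h⟩ := hR z (Finset.sdiff_subset hz)
        exact ⟨S, hS, fun y hy => h y (Finset.sdiff_subset hy)⟩) (by nlinarith)
    have hBQ : ∀ z ∈ B, z ∈ A ∧ z ≠ x ∧ ¬ R x z ∧ ¬ R z x := by
      intro z hz
      have := Finset.mem_sdiff.1 (hB hz)
      simp only [hQ, Finset.mem_insert, Finset.mem_union, Finset.mem_filter] at this
      tauto
    refine ⟨insert x B, Finset.insert_subset hx fun z hz => (hBQ z hz).1, ?_, ?_⟩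
    · rw [Finset.card_insert_of_notMem fun h => (hBQ x h).2.1 rfl, hBm]
    · intro a ha b hb hab
      rw [Finset.mem_insert] at ha hb
      rcases ha with rfl | ha <;> rcases hb with rfl | hb
      · exact absurd rfl hab
      · exact (hBQ b hb).2.2.1
      · exact (hBQ a ha).2.2.2
      · exact hind a ha b hb hab

/-! ### Minimal unavoidable graphs. -/

/-- Allows properness of a subgraph to be transferred along isomorphisms and inclusions. -/
theorem subgraph_map_injective {U V : Type*} {K : SimpleGraph U} {G : SimpleGraph V} {f : K →g G}
    (hf : Function.Injective f) : Function.Injective (Subgraph.map f) := by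
  intro H H' h
  ext a b
  · have := congrArg (fun L => f a ∈ L.verts) h
    simpa [hf.eq_iff] using this
  · have := congrArg (fun L => L.Adj (f a) (f b)) h
    simpa [Relation.Map, hf.eq_iff] using this

theorem MinimalUnavoidable.of_iso {U V W : Type*} {K : SimpleGraph U} {G : SimpleGraph V}
    {F : SimpleGraph W} (h : MinimalUnavoidable K F) (i : K ≃g G) : MinimalUnavoidable G F := by
  refine ⟨h.1.mono i.isContained, fun H hH hF => ?_⟩
  refine h.2 (H.map i.symm.toHom) (fun htop => hH ?_)
    (hF.mono (i.symm.toCopy.isoSubgraphMap H).isContained)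
  apply subgraph_map_injective (f := i.symm.toHom) i.symm.injective
  rw [htop]
  ext a b
  · simp
  · simp only [Subgraph.top_adj, Subgraph.map_adj, Relation.Map]
    constructor
    · intro hab
      exact ⟨i a, i b, i.map_adj_iff.2 hab, i.symm_apply_apply a, i.symm_apply_apply b⟩
    · rintro ⟨x, y, hxy, rfl, rfl⟩
      exact i.symm.map_adj_iff.2 hxy

/-- Every finite unavoidable graph contains a minimal one. -/
theorem Unavoidable.exists_minimal {V W : Type*} [Finite V] {G : SimpleGraph V}
    {F : SimpleGraph W} (h : Unavoidable G F) :
    ∃ (n : ℕ) (K : SimpleGraph (Fin n)), K ⊑ G ∧ MinimalUnavoidable K F := by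
  have htop : Unavoidable (⊤ : G.Subgraph).coe F := h.mono Subgraph.topIso.isContained'
  obtain ⟨H, hH⟩ := (Set.toFinite {H : G.Subgraph | Unavoidable H.coe F}).exists_minimal ⟨⊤, htop⟩
  have hmin : MinimalUnavoidable H.coe F := by
    refine ⟨hH.prop, fun H' hne hU => hne ?_⟩
    have hiso := H.coeCopy.isoSubgraphMap H'
    have hle : H'.map H.hom ≤ H := by
      refine (Subgraph.map_monotone (f := H.hom) (le_top : H' ≤ ⊤)).trans ?_
      rw [Subgraph.map_hom_top]
    have hge := hH.le_of_le (y := H'.map H.hom) (hU.mono hiso.isContained) hle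
    apply subgraph_map_injective Subgraph.hom_injective
    rw [Subgraph.map_hom_top]
    exact le_antisymm hle hge
  obtain ⟨n, ⟨e⟩⟩ := Finite.exists_equiv_fin H.verts
  exact ⟨n, H.coe.map e.toEmbedding, (Iso.map e H.coe).isContained'.trans H.coe_isContained,
    hmin.of_iso (Iso.map e H.coe)⟩

/-- Minimal unavoidable graphs form an antichain for containment. -/
theorem MinimalUnavoidable.nonempty_iso {U V W : Type*} {K : SimpleGraph U} {G : SimpleGraph V}
    {F : SimpleGraph W} (hK : Unavoidable K F) (hG : MinimalUnavoidable G F) (h : K ⊑ G) :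
    Nonempty (K ≃g G) := by
  obtain ⟨φ⟩ := h
  have htop : φ.toSubgraph = ⊤ := by
    by_contra hne
    exact hG.2 _ hne (hK.mono φ.isoToSubgraph.isContained)
  have i := φ.isoToSubgraph
  rw [htop] at i
  exact ⟨i.trans Subgraph.topIso⟩

/-- `𝓜(F)` is infinite if some unavoidable graphs have only large unavoidable subgraphs. -/
theorem infinite_minimalUnavoidableGraphs {W : Type*} {F : SimpleGraph W}
    (h : ∀ N : ℕ, ∃ (V : Type) (_ : Finite V) (G : SimpleGraph V), Unavoidable G F ∧
      ∀ n ≤ N, ∀ K : SimpleGraph (Fin n), K ⊑ G → ¬ Unavoidable K F) :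
    (minimalUnavoidableGraphs F).Infinite := by
  intro hfin
  let size : FiniteGraphClass → ℕ := Quotient.lift (fun G => G.1) fun G H ⟨e⟩ => by
    simpa using Fintype.card_congr e.toEquiv
  obtain ⟨N, hN⟩ := (hfin.image size).bddAbove
  obtain ⟨V, _, G, hG, hsmall⟩ := h N
  obtain ⟨n, K, hK, hmin⟩ := hG.exists_minimal
  refine hsmall n (hN ⟨⟦⟨n, K⟩⟧, ⟨⟨n, K⟩, rfl, hmin⟩, rfl⟩) K hK hmin.1

/-! ### Finiteness for matchings. -/

/-- An injection defined on a subset extends to the whole type if there is enough room. -/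
theorem exists_extend_injective {W V : Type*} [Finite W] [Finite V] {s : Set W} (f : s → V)
    (hf : Function.Injective f) (hc : Nat.card W ≤ Nat.card V) :
    ∃ φ : W → V, Function.Injective φ ∧ ∀ w : s, φ w = f w := by
  classical
  have h1 : s.ncard + sᶜ.ncard = Nat.card W := Set.ncard_add_ncard_compl s
  have h2 : (Set.range f).ncard + (Set.range f)ᶜ.ncard = Nat.card V :=
    Set.ncard_add_ncard_compl _
  have h3 : (Set.range f).ncard = s.ncard := by
    rw [← Set.image_univ, Set.ncard_image_of_injective _ hf, Set.ncard_univ]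
    rfl
  have h4 : Nat.card ↥(sᶜ) ≤ Nat.card ↥((Set.range f)ᶜ) := by
    change sᶜ.ncard ≤ (Set.range f)ᶜ.ncard
    omega
  obtain ⟨k, hk⟩ : ∃ k : ↥(sᶜ) → ↥((Set.range f)ᶜ), Function.Injective k := by
    have := Fintype.ofFinite ↥(sᶜ)
    have := Fintype.ofFinite ↥((Set.range f)ᶜ)
    rw [Nat.card_eq_fintype_card, Nat.card_eq_fintype_card] at h4
    obtain ⟨k⟩ := Function.Embedding.nonempty_of_card_le h4
    exact ⟨k, k.injective⟩
  refine ⟨fun w => if h : w ∈ s then f ⟨w, h⟩ else k ⟨w, h⟩, ?_, fun w => by simp⟩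
  intro a b hab
  by_cases ha : a ∈ s <;> by_cases hb : b ∈ s <;> simp only [ha, hb, dite_true, dite_false] at hab
  · simpa using hf hab
  · exact absurd ⟨_, hab⟩ (k ⟨b, hb⟩).2
  · exact absurd ⟨_, hab.symm⟩ (k ⟨a, ha⟩).2
  · simpa using hk (Subtype.ext hab)

/-- A matching of size `3 t` is unavoidable for `t K₂`, also with additional isolated vertices. -/
theorem unavoidable_of_matchingGraph_isContained {V W : Type*} [Finite V] [Finite W]
    {G : SimpleGraph V} {F : SimpleGraph W} {t : ℕ} (i : F.induce F.support ≃g matchingGraph t)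
    (hG : matchingGraph (3 * t) ⊑ G) (hc : Nat.card W ≤ Nat.card V) : Unavoidable G F := by
  classical
  obtain ⟨ψ⟩ := hG
  refine unavoidable_iff.2 fun g => ?_
  let E : Fin (3 * t) → Sym2 V := fun j => s(ψ (j, 0), ψ (j, 1))
  have hE : Function.Injective E := by
    intro a b hab
    rcases Sym2.eq_iff.1 hab with h | h
    · exact congrArg Prod.fst (ψ.injective h.1)
    · exact congrArg Prod.fst (ψ.injective h.1)
  obtain ⟨B, hB, hind, hcard⟩ := exists_independent_third g (Finset.univ.image E)
  rw [Finset.card_image_of_injective _ hE, Finset.card_univ, Fintype.card_fin] at hcard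
  obtain ⟨ι⟩ := Function.Embedding.nonempty_of_card_le (α := Fin t) (β := B) (by simp; omega)
  have hι : ∀ a, ∃ j, E j = ι a := fun a => by simpa using hB (ι a).2
  choose κ hκ using hι
  have hκi : Function.Injective κ := by
    intro a b hab
    apply ι.injective
    apply Subtype.ext
    rw [← hκ, ← hκ, hab]
  -- The isolated vertices of `F` go to arbitrary unused vertices; `hc` provides the room.
  obtain ⟨φ, hφ, hφs⟩ := exists_extend_injective
    (fun w : F.support => ψ (κ (i w).1, (i w).2)) (by
      intro a b hab
      have := ψ.injective hab
      simp only [Prod.mk.injEq] at this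
      exact i.injective (Prod.ext (hκi this.1) this.2)) hc
  have hadj : ∀ {u v : W}, F.Adj u v → ∃ a, G.Adj (φ u) (φ v) ∧ s(φ u, φ v) = E (κ a) := by
    intro u v huv
    have hu : u ∈ F.support := ⟨v, huv⟩
    have hv : v ∈ F.support := ⟨u, huv.symm⟩
    have h : (matchingGraph t).Adj (i ⟨u, hu⟩) (i ⟨v, hv⟩) := i.map_adj_iff.2 huv
    refine ⟨(i ⟨u, hu⟩).1, ?_⟩
    rw [hφs ⟨u, hu⟩, hφs ⟨v, hv⟩]
    generalize i ⟨u, hu⟩ = x at h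
    generalize i ⟨v, hv⟩ = y at h
    obtain ⟨x, p⟩ := x
    obtain ⟨y, q⟩ := y
    obtain ⟨h1, h2⟩ := h
    dsimp only at h1 h2
    subst h1
    refine ⟨ψ.toHom.map_adj ⟨rfl, h2⟩, ?_⟩
    fin_cases p <;> fin_cases q
    · exact absurd rfl h2
    · rfl
    · exact Sym2.eq_swap
    · exact absurd rfl h2
  refine ⟨⟨⟨φ, fun h => (hadj h).choose_spec.1⟩, hφ⟩, ?_⟩
  have hedge : ∀ e ∈ F.edgeSet, e.map φ ∈ B := by
    intro e
    induction e using Sym2.ind with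
    | _ u v =>
      intro he
      obtain ⟨a, -, ha⟩ := hadj he
      rw [Sym2.map_mk, ha, hκ]
      exact (ι a).2
  intro e he e' he' hne
  exact hind _ (hedge e he) _ (hedge e' he') fun h => hne (Sym2.map.injective hφ h)

/-- A graph without a matching of size `T` has a vertex cover of size at most `2 T`. -/
theorem exists_cover_of_not_matchingGraph_isContained {V : Type*} [Finite V] {G : SimpleGraph V}
    {T : ℕ} (h : ¬ matchingGraph T ⊑ G) :
    ∃ C : Finset V, C.card ≤ 2 * T ∧ ∀ u v, G.Adj u v → u ∈ C ∨ v ∈ C := by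
  classical
  induction T with
  | zero => exact absurd IsContained.of_isEmpty h
  | succ T ih =>
    -- The vertices of a matching of size `T` form a cover, because an uncovered edge would enlarge
    -- the matching to size `T + 1`.
    by_cases hT : matchingGraph T ⊑ G
    · obtain ⟨ψ⟩ := hT
      refine ⟨Finset.univ.image ψ, ?_, ?_⟩
      · refine Finset.card_image_le.trans ?_
        simp
        omega
      · intro u v huv
        by_contra! hcon
        simp only [Finset.mem_image, Finset.mem_univ, true_and, not_exists] at hcon
        obtain ⟨hu, hv⟩ := hcon
        apply h
        let χ : Fin (T + 1) × Fin 2 → V := fun x =>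
          Fin.lastCases (motive := fun _ => V) (if x.2 = 0 then u else v)
            (fun j => ψ (j, x.2)) x.1
        refine ⟨⟨⟨χ, ?_⟩, ?_⟩⟩
        · rintro ⟨a, p⟩ ⟨b, q⟩ ⟨h1, h2⟩
          dsimp only at h1 h2
          subst h1
          induction a using Fin.lastCases with
          | last =>
            simp only [χ, Fin.lastCases_last]
            fin_cases p <;> fin_cases q <;> simp_all [huv.symm]
          | cast j =>
            simp only [χ, Fin.lastCases_castSucc]
            exact ψ.toHom.map_adj ⟨rfl, h2⟩
        · rintro ⟨a, p⟩ ⟨b, q⟩ hab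
          change χ (a, p) = χ (b, q) at hab
          have huv' := huv.ne
          induction a using Fin.lastCases with
          | last =>
            induction b using Fin.lastCases with
            | last =>
              simp only [χ, Fin.lastCases_last] at hab
              fin_cases p <;> fin_cases q <;> simp_all
            | cast k =>
              simp only [χ, Fin.lastCases_last, Fin.lastCases_castSucc] at hab
              split_ifs at hab
              · exact absurd hab.symm (hu _)
              · exact absurd hab.symm (hv _)
          | cast j =>
            induction b using Fin.lastCases with
            | last =>
              simp only [χ, Fin.lastCases_last, Fin.lastCases_castSucc] at hab
              split_ifs at hab
              · exact absurd hab (hu _)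
              · exact absurd hab (hv _)
            | cast k =>
              simp only [χ, Fin.lastCases_castSucc] at hab
              have := ψ.injective hab
              simp_all
    · obtain ⟨C, hC, h⟩ := ih hT
      exact ⟨C, by omega, h⟩

/-- Containment of graphs with indexed vertex covers of the same size can be read off from the number
of vertices outside the covers with a given neighbourhood. -/
theorem isContained_of_cover {V V' : Type*} [Finite V] [Finite V'] {c : ℕ} {G : SimpleGraph V}
    {G' : SimpleGraph V'} {κ : Fin c → V} {κ' : Fin c → V'} (hκ' : Function.Injective κ')
    (hcov : ∀ u v, G.Adj u v → u ∈ Set.range κ ∨ v ∈ Set.range κ)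
    (hadj : ∀ a b, G.Adj (κ a) (κ b) → G'.Adj (κ' a) (κ' b))
    (hnum : ∀ S : Set (Fin c), Nat.card {v // v ∉ Set.range κ ∧ {a | G.Adj v (κ a)} = S} ≤
      Nat.card {v // v ∉ Set.range κ' ∧ {a | G'.Adj v (κ' a)} = S}) : G ⊑ G' := by
  classical
  have hemb : ∀ S : Set (Fin c), Nonempty ({v // v ∉ Set.range κ ∧ {a | G.Adj v (κ a)} = S} ↪
      {v // v ∉ Set.range κ' ∧ {a | G'.Adj v (κ' a)} = S}) := by
    intro S
    have := Fintype.ofFinite {v // v ∉ Set.range κ ∧ {a | G.Adj v (κ a)} = S}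
    have := Fintype.ofFinite {v // v ∉ Set.range κ' ∧ {a | G'.Adj v (κ' a)} = S}
    have h := hnum S
    rw [Nat.card_eq_fintype_card, Nat.card_eq_fintype_card] at h
    exact Function.Embedding.nonempty_of_card_le h
  have η := fun S => (hemb S).some
  have hη : ∀ {S : Set (Fin c)} {v w} (hv) (hw), (η S ⟨v, hv⟩ : V') = η S ⟨w, hw⟩ → v = w := by
    intro S v w hv hw h
    simpa using (η S).injective (Subtype.ext h)
  -- Vertices outside the cover are pairwise nonadjacent, so it suffices to keep the neighbourhood
  -- of each in the cover. Distinct neighbourhoods have disjoint targets, which gives injectivity.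
  let φ : V → V' := fun v => if h : v ∈ Set.range κ then κ' h.choose else η _ ⟨v, h, rfl⟩
  have hin : ∀ {v} (h : v ∈ Set.range κ), φ v = κ' h.choose := fun h => dif_pos h
  have hout : ∀ {v} (h : v ∉ Set.range κ) {S} (hS : {a | G.Adj v (κ a)} = S),
      φ v = η S ⟨v, h, hS⟩ := by
    rintro v h S rfl
    exact dif_neg h
  have hnbr : ∀ {v} (_ : v ∉ Set.range κ), φ v ∉ Set.range κ' ∧
      {a | G'.Adj (φ v) (κ' a)} = {a | G.Adj v (κ a)} := by
    intro v h
    rw [hout h rfl]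
    exact (η _ ⟨v, h, rfl⟩).2
  have hedge : ∀ {v w}, v ∉ Set.range κ → w ∈ Set.range κ → G.Adj v w → G'.Adj (φ v) (φ w) := by
    intro v w hv hw hvw
    rw [hin hw]
    have h1 : hw.choose ∈ {a | G.Adj v (κ a)} := by
      simpa [hw.choose_spec] using hvw
    rw [← (hnbr hv).2] at h1
    exact h1
  refine ⟨⟨⟨φ, ?_⟩, ?_⟩⟩
  · intro v w hvw
    by_cases hv : v ∈ Set.range κ <;> by_cases hw : w ∈ Set.range κ
    · rw [hin hv, hin hw]
      apply hadj
      rwa [hv.choose_spec, hw.choose_spec]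
    · exact (hedge hw hv hvw.symm).symm
    · exact hedge hv hw hvw
    · exact absurd (hcov v w hvw) (by tauto)
  · intro v w hvw
    change φ v = φ w at hvw
    by_cases hv : v ∈ Set.range κ <;> by_cases hw : w ∈ Set.range κ
    · rw [hin hv, hin hw] at hvw
      rw [← hv.choose_spec, ← hw.choose_spec, hκ' hvw]
    · rw [hin hv] at hvw
      exact absurd ⟨_, hvw⟩ (hnbr hw).1
    · rw [hin hw] at hvw
      exact absurd ⟨_, hvw.symm⟩ (hnbr hv).1
    · have hS : {a | G.Adj w (κ a)} = {a | G.Adj v (κ a)} := by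
        rw [← (hnbr hv).2, ← (hnbr hw).2, hvw]
      rw [hout hv rfl, hout hw hS] at hvw
      exact hη _ _ hvw

/-- Only finitely many minimal unavoidable graphs have a vertex cover of a given size. -/
theorem finite_minimalUnavoidable_cover {W : Type*} (F : SimpleGraph W) (c : ℕ) :
    {x : FiniteGraphClass | ∃ G : Σ n : ℕ, SimpleGraph (Fin n), ⟦G⟧ = x ∧
      MinimalUnavoidable G.2 F ∧ ∃ κ : Fin c → Fin G.1, Function.Injective κ ∧
        ∀ u v, G.2.Adj u v → u ∈ Set.range κ ∨ v ∈ Set.range κ}.Finite := by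
  classical
  by_contra hinf
  let x := Set.Infinite.natEmbedding _ hinf
  choose G hG hmin κ hκ hcov using fun m => (x m).2
  -- Finitely many natural numbers describe each graph, so Dickson's lemma gives `i < j` with
  -- comparable data. Adjacency is coded by 0 and 1 to make `≤` an implication.
  let data : ℕ → ((Fin c × Fin c) ⊕ Set (Fin c)) → ℕ := fun m => Sum.elim
    (fun p => if (G m).2.Adj (κ m p.1) (κ m p.2) then 1 else 0)
    (fun S => Nat.card {v // v ∉ Set.range (κ m) ∧ {a | (G m).2.Adj v (κ m a)} = S})
  obtain ⟨i, j, hij, hle⟩ := wellQuasiOrdered_le data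
  have hcont : (G i).2 ⊑ (G j).2 := by
    refine isContained_of_cover (hκ j) (hcov i) (fun a b hab => ?_) (fun S => hle (Sum.inr S))
    have := hle (Sum.inl (a, b))
    by_contra hne
    simp [data, hab, hne] at this
  have hiso := MinimalUnavoidable.nonempty_iso (hmin i).1 (hmin j) hcont
  have : x i = x j := Subtype.ext (by
    rw [← hG i, ← hG j]
    exact Quotient.sound hiso)
  exact hij.ne (x.injective this)

/-- `𝓜(F)` is finite if `F` is a matching together with isolated vertices. -/
theorem finite_minimalUnavoidableGraphs {W : Type*} [Finite W] {F : SimpleGraph W} {t : ℕ}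
    (i : F.induce F.support ≃g matchingGraph t) : (minimalUnavoidableGraphs F).Finite := by
  classical
  set c := 2 * (3 * t) with hc
  set N := c + Nat.card W with hN
  have hsmall : (Set.range fun x : (Σ n : Fin (N + 1), SimpleGraph (Fin n)) =>
      (⟦⟨x.1, x.2⟩⟧ : FiniteGraphClass)).Finite := Set.finite_range _
  refine (hsmall.union (finite_minimalUnavoidable_cover F c)).subset ?_
  rintro _ ⟨⟨n, G⟩, rfl, hG⟩
  by_cases hn : n ≤ N
  · exact Or.inl ⟨⟨⟨n, by omega⟩, G⟩, rfl⟩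
  right
  -- As `n > 6t + |W|`, some vertex is off the matching, and at least `|W|` vertices remain after
  -- its deletion.
  have hT : ¬ matchingGraph (3 * t) ⊑ G := by
    rintro ⟨ψ⟩
    obtain ⟨v, hv⟩ : ∃ v, v ∉ Set.range ψ := by
      by_contra! hcon
      have := Nat.card_le_card_of_surjective ψ fun v => hcon v
      simp at this
      omega
    refine hG.2 ((⊤ : G.Subgraph).deleteVerts {v}) (fun h => ?_) ?_
    · have : v ∈ ((⊤ : G.Subgraph).deleteVerts {v}).verts := by
        rw [h]
        trivial
      simp at this
    · refine unavoidable_of_matchingGraph_isContained i ?_ ?_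
      · refine ⟨⟨⟨fun x => ⟨ψ x, ?_⟩, ?_⟩, ?_⟩⟩
        · simp only [Subgraph.deleteVerts_verts, Subgraph.verts_top, Set.mem_sdiff, Set.mem_univ,
            Set.mem_singleton_iff, true_and]
          exact fun h => hv ⟨x, h⟩
        · intro a b hab
          have h1 := ψ.toHom.map_adj hab
          simp only [Subgraph.coe_adj, Subgraph.deleteVerts_adj, Subgraph.verts_top, Set.mem_univ,
            Set.mem_singleton_iff, true_and, Subgraph.top_adj]
          exact ⟨fun h => hv ⟨a, h⟩, fun h => hv ⟨b, h⟩, h1⟩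
        · intro a b hab
          exact ψ.injective (congrArg Subtype.val hab)
      · have : Nat.card ((⊤ : G.Subgraph).deleteVerts {v}).verts = n - 1 := by
          change Set.ncard _ = _
          rw [Subgraph.deleteVerts_verts, Subgraph.verts_top,
            Set.ncard_sdiff_singleton_of_mem (Set.mem_univ _)]
          simp
        omega
  obtain ⟨C, hC, hcov⟩ := exists_cover_of_not_matchingGraph_isContained hT
  obtain ⟨D, hCD, -, hD⟩ := Finset.exists_subsuperset_card_eq (Finset.subset_univ C)
    (n := c) (by omega) (by simp; omega)
  refine ⟨⟨n, G⟩, rfl, hG, fun a => D.equivFin.symm (a.cast hD.symm), ?_, ?_⟩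
  · intro a b hab
    simpa using hab
  · have key : ∀ u ∈ C, u ∈ Set.range fun a : Fin c =>
        (D.equivFin.symm (a.cast hD.symm) : Fin n) := by
      intro u hu
      exact ⟨(D.equivFin ⟨u, hCD hu⟩).cast hD, by simp⟩
    exact fun u v huv => (hcov u v huv).imp (key u) (key v)

/-! ### Forests containing a path with three edges. -/

/-- Every nonempty finite set of vertices of an acyclic graph contains a vertex with at most one
neighbour in the set. -/
theorem exists_mem_subsingleton_neighbors {V : Type*} {G : SimpleGraph V} (hG : G.IsAcyclic)
    {S : Finset V} (hS : S.Nonempty) :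
    ∃ v ∈ S, ∀ u ∈ S, ∀ w ∈ S, G.Adj v u → G.Adj v w → u = w := by
  classical
  have hac : (G.induce (S : Set V)).IsAcyclic := hG.induce _
  have : Nonempty (S : Set V) := hS.to_subtype
  -- At an end of a longest path, a second neighbour would close a cycle or lengthen the path.
  obtain ⟨u, v, p, hp, hmax⟩ :=
    Walk.exists_isPath_forall_isPath_length_le_length (G.induce (S : Set V))
  have key : ∀ w : (S : Set V), (G.induce (S : Set V)).Adj u w → w = p.snd := by
    intro w hw
    refine hac.eq_snd_of_adj_start hp hw ?_
    by_contra hns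
    have := hmax _ _ (Walk.cons hw.symm p) (hp.cons hns)
    simp at this
  refine ⟨u, u.2, fun a ha b hb hua hub => ?_⟩
  exact congrArg Subtype.val ((key ⟨a, ha⟩ hua).trans (key ⟨b, hb⟩ hub).symm)

/-- In a finite acyclic graph every edge joins a vertex to its parent, for a suitable parent map. -/
theorem exists_parent_of_isAcyclic {V : Type*} [Finite V] {G : SimpleGraph V} (hG : G.IsAcyclic) :
    ∃ p : V → V, ∀ u v, G.Adj u v → p u = v ∨ p v = u := by
  classical
  have := Fintype.ofFinite V
  suffices h : ∀ S : Finset V, ∃ p : V → V, ∀ u ∈ S, ∀ v ∈ S, G.Adj u v → p u = v ∨ p v = u by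
    obtain ⟨p, hp⟩ := h Finset.univ
    exact ⟨p, fun u v => hp u (Finset.mem_univ u) v (Finset.mem_univ v)⟩
  intro S
  induction S using Finset.strongInduction with
  | H S ih =>
  rcases S.eq_empty_or_nonempty with rfl | hS
  · exact ⟨id, by simp⟩
  obtain ⟨x, hx, huniq⟩ := exists_mem_subsingleton_neighbors hG hS
  obtain ⟨p, hp⟩ := ih (S.erase x) (Finset.erase_ssubset hx)
  obtain ⟨y, hy⟩ : ∃ y, ∀ u ∈ S, G.Adj x u → y = u := by
    by_cases h : ∃ u ∈ S, G.Adj x u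
    · obtain ⟨u, hu, hxu⟩ := h
      exact ⟨u, fun w hw hxw => huniq u hu w hw hxu hxw⟩
    · exact ⟨x, fun u hu hxu => absurd ⟨u, hu, hxu⟩ h⟩
  refine ⟨Function.update p x y, fun u hu v hv huv => ?_⟩
  by_cases hux : u = x
  · subst hux
    exact Or.inl (by simpa using hy v hv huv)
  · by_cases hvx : v = x
    · subst hvx
      exact Or.inr (by simpa using hy u hu huv.symm)
    · simpa [hux, hvx] using hp u (Finset.mem_erase.2 ⟨hux, hu⟩) v (Finset.mem_erase.2 ⟨hvx, hv⟩) huv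

/-- Acyclic graphs are avoidable for graphs containing a path with three edges: send the edge from
`v` to its parent to the edge from the parent to the grandparent. -/
theorem not_unavoidable_of_isAcyclic {V W : Type*} [Finite V] {G : SimpleGraph V}
    {F : SimpleGraph W} (hG : G.IsAcyclic) {a b c d : W} (hab : F.Adj a b) (hbc : F.Adj b c)
    (hcd : F.Adj c d) (hac : a ≠ c) (hbd : b ≠ d) : ¬ Unavoidable G F := by
  classical
  intro hU
  obtain ⟨p, hp⟩ := exists_parent_of_isAcyclic hG
  obtain ⟨φ, hφ⟩ := unavoidable_iff.1 hU
    fun e => if h : ∃ v, e = s(v, p v) then s(p h.choose, p (p h.choose)) else e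
  -- If `φ z` is the parent of `φ y`, then `φ y` must be the parent of `φ x`, and the map sends the
  -- first edge to the second.
  have key : ∀ x y z, F.Adj x y → F.Adj y z → x ≠ z → p (φ y) ≠ φ z := by
    intro x y z hxy hyz hxz hpy
    refine hφ s(x, y) hxy s(y, z) hyz ?_ ?_
    · intro h
      rcases Sym2.eq_iff.1 h with h | h
      · exact hxy.ne h.1
      · exact hxz h.1
    · have hxp : p (φ x) = φ y := by
        rcases hp _ _ (φ.toHom.map_adj hxy) with h | h
        · exact h
        · exact absurd (φ.injective (h.symm.trans hpy)) hxz
      have hex : ∃ v, Sym2.map φ s(x, y) = s(v, p v) := ⟨φ x, by rw [hxp, Sym2.map_mk]⟩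
      have hch : hex.choose = φ x := by
        rcases Sym2.eq_iff.1 hex.choose_spec with h | h
        · exact h.1.symm
        · rw [← h.2, hpy] at h
          exact absurd (φ.injective h.1) hxz
      refine (dif_pos hex).trans ?_
      rw [hch, hxp, hpy, Sym2.map_mk]
  -- Whichever way the middle edge points, the path has an edge behind it.
  rcases hp _ _ (φ.toHom.map_adj hbc) with h | h
  · exact key a b c hab hbc hac h
  · exact key d c b hcd.symm hbc.symm hbd.symm h

/-- A forest embeds greedily into a graph with large minimum degree on some set of vertices. -/
theorem isContained_of_isAcyclic {V W : Type*} [Fintype W] {F : SimpleGraph W} {G : SimpleGraph V}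
    [DecidableRel G.Adj] (hF : F.IsAcyclic) {S : Finset V} (hS : S.Nonempty)
    (hdeg : ∀ v ∈ S, Fintype.card W ≤ (S.filter fun u => G.Adj v u).card) : F ⊑ G := by
  classical
  suffices h : ∀ T : Finset W, ∃ φ : W → V, (∀ x ∈ T, φ x ∈ S) ∧ Set.InjOn φ T ∧
      ∀ x ∈ T, ∀ y ∈ T, F.Adj x y → G.Adj (φ x) (φ y) by
    obtain ⟨φ, -, hinj, hadj⟩ := h Finset.univ
    refine ⟨⟨⟨φ, fun {x y} h => hadj x (Finset.mem_univ x) y (Finset.mem_univ y) h⟩, ?_⟩⟩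
    intro x y h
    exact hinj (by simp) (by simp) h
  intro T
  induction T using Finset.strongInduction with
  | H T ih =>
  obtain ⟨s, hs⟩ := hS
  rcases T.eq_empty_or_nonempty with rfl | hT
  · exact ⟨fun _ => s, by simp⟩
  obtain ⟨x, hx, huniq⟩ := exists_mem_subsingleton_neighbors hF hT
  obtain ⟨φ, hφS, hφi, hφa⟩ := ih (T.erase x) (Finset.erase_ssubset hx)
  obtain ⟨y, hyS, hy⟩ : ∃ y ∈ S, ∀ u ∈ T, F.Adj x u → φ u = y := by
    by_cases h : ∃ u ∈ T, F.Adj x u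
    · obtain ⟨u, hu, hxu⟩ := h
      exact ⟨φ u, hφS u (Finset.mem_erase.2 ⟨hxu.ne', hu⟩), fun w hw hxw =>
        congrArg φ (huniq w hw u hu hxw hxu)⟩
    · exact ⟨s, hs, fun u hu hxu => absurd ⟨u, hu, hxu⟩ h⟩
  -- The removed vertex `x` has at most one neighbour in `T`; its image needs only to be an unused
  -- neighbour of `y`, and fewer than `|W|` vertices are used.
  obtain ⟨z, hz, hzT⟩ : ∃ z ∈ S.filter (fun u => G.Adj y u), z ∉ (T.erase x).image φ := by
    apply Finset.exists_mem_notMem_of_card_lt_card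
    have h1 : ((T.erase x).image φ).card ≤ (T.erase x).card := Finset.card_image_le
    have h2 := Finset.card_erase_lt_of_mem hx
    have h3 := Finset.card_le_univ T
    have h4 := hdeg y hyS
    omega
  obtain ⟨hzS, hyz⟩ := Finset.mem_filter.1 hz
  have hne : ∀ u ∈ T, u ≠ x → φ u ≠ z := by
    rintro u hu hux rfl
    exact hzT (Finset.mem_image_of_mem φ (Finset.mem_erase.2 ⟨hux, hu⟩))
  refine ⟨Function.update φ x z, ?_, ?_, ?_⟩
  · intro u hu
    by_cases hux : u = x
    · simpa [hux] using hzS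
    · simpa [hux] using hφS u (Finset.mem_erase.2 ⟨hux, hu⟩)
  · intro u hu w hw h
    by_cases hux : u = x <;> by_cases hwx : w = x
    · rw [hux, hwx]
    · simp only [hux, hwx, Function.update_self, ne_eq, not_false_eq_true,
        Function.update_of_ne] at h
      exact absurd h.symm (hne w hw hwx)
    · simp only [hux, hwx, Function.update_self, ne_eq, not_false_eq_true,
        Function.update_of_ne] at h
      exact absurd h (hne u hu hux)
    · simp only [hux, hwx, ne_eq, not_false_eq_true, Function.update_of_ne] at h
      exact hφi (Finset.mem_coe.2 (Finset.mem_erase.2 ⟨hux, hu⟩))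
        (Finset.mem_coe.2 (Finset.mem_erase.2 ⟨hwx, hw⟩)) h
  · intro u hu w hw huw
    by_cases hux : u = x
    · subst hux
      have hwu : w ≠ u := huw.ne'
      rw [Function.update_self, Function.update_of_ne hwu, hy w hw huw]
      exact hyz.symm
    · by_cases hwx : w = x
      · subst hwx
        rw [Function.update_self, Function.update_of_ne hux, hy u hu huw.symm]
        exact hyz
      · rw [Function.update_of_ne hux, Function.update_of_ne hwx]
        exact hφa u (Finset.mem_erase.2 ⟨hux, hu⟩) w (Finset.mem_erase.2 ⟨hwx, hw⟩) huw

/-- A set of at least `d |V|` pairs spans a nonempty set of vertices with minimum degree `d`. -/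
theorem exists_finset_minDegree {V : Type*} [Fintype V] [Nonempty V] [DecidableEq V]
    (A : Finset (Sym2 V)) (d : ℕ) (hA : d * Fintype.card V ≤ A.card) :
    ∃ S : Finset V, S.Nonempty ∧ ∀ v ∈ S, d ≤ (S.filter fun u => s(v, u) ∈ A).card := by
  -- In a smallest `S` with average `d`, deleting a vertex in fewer than `d` pairs would leave a
  -- smaller set satisfying the inequality strictly, hence a nonempty one.
  have hne : (Finset.univ.filter fun S : Finset V => S.Nonempty ∧
      d * S.card ≤ (A.filter fun e => ∀ x ∈ e, x ∈ S).card).Nonempty :=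
    ⟨Finset.univ, by simpa using hA⟩
  obtain ⟨S, hS, hmin⟩ := Finset.exists_min_image _ Finset.card hne
  simp only [Finset.mem_filter, Finset.mem_univ, true_and] at hS hmin
  refine ⟨S, hS.1, fun v hv => ?_⟩
  by_contra! hlt
  have h1 : (A.filter fun e => ∀ x ∈ e, x ∈ S) ⊆ (A.filter fun e => ∀ x ∈ e, x ∈ S.erase v) ∪
      (S.filter fun u => s(v, u) ∈ A).image fun u => s(v, u) := by
    intro e he
    rw [Finset.mem_filter] at he
    by_cases hve : v ∈ e
    · obtain ⟨u, rfl⟩ := Sym2.mem_iff_exists.1 hve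
      refine Finset.mem_union_right _ (Finset.mem_image.2 ⟨u, ?_, rfl⟩)
      exact Finset.mem_filter.2 ⟨he.2 u (Sym2.mem_mk_right v u), he.1⟩
    · refine Finset.mem_union_left _ (Finset.mem_filter.2 ⟨he.1, fun x hx => ?_⟩)
      exact Finset.mem_erase.2 ⟨fun h => hve (h ▸ hx), he.2 x hx⟩
  have h2 := (Finset.card_le_card h1).trans (Finset.card_union_le _ _)
  have h3 : ((S.filter fun u => s(v, u) ∈ A).image fun u => s(v, u)).card ≤
      (S.filter fun u => s(v, u) ∈ A).card := Finset.card_image_le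
  have h4 : (S.erase v).card + 1 = S.card := Finset.card_erase_add_one hv
  have h5 : d * (S.erase v).card + d = d * S.card := by rw [← h4, mul_add, mul_one]
  have h6 : d * (S.erase v).card < (A.filter fun e => ∀ x ∈ e, x ∈ S.erase v).card := by omega
  have h7 : (S.erase v).Nonempty := by
    obtain ⟨e, he⟩ := Finset.card_pos.1 (Nat.zero_lt_of_lt h6)
    induction e using Sym2.ind with
    | _ x y => exact ⟨x, (Finset.mem_filter.1 he).2 x (Sym2.mem_mk_left x y)⟩
  have := hmin (S.erase v) ⟨h7, h6.le⟩
  omega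

/-- Graphs with many edges are unavoidable for forests. -/
theorem unavoidable_of_card_edgeFinset {V W : Type*} [Fintype V] [Nonempty V] [Fintype W]
    {F : SimpleGraph W} {G : SimpleGraph V} [Fintype G.edgeSet] (hF : F.IsAcyclic)
    (hG : 3 * Fintype.card W * Fintype.card V ≤ G.edgeFinset.card) : Unavoidable G F := by
  classical
  refine unavoidable_iff.2 fun g => ?_
  obtain ⟨B, hB, hind, hcard⟩ := exists_independent_third g G.edgeFinset
  obtain ⟨S, hS, hdeg⟩ := exists_finset_minDegree B (Fintype.card W) (by nlinarith)
  have hBG : ∀ {u v}, s(u, v) ∈ B → G.Adj u v := fun h => by simpa using hB h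
  have hadj : ∀ u v, (fromEdgeSet (B : Set (Sym2 V))).Adj u v ↔ s(u, v) ∈ B := by
    intro u v
    rw [fromEdgeSet_adj]
    exact ⟨fun h => h.1, fun h => ⟨h, (hBG h).ne⟩⟩
  obtain ⟨φ⟩ := isContained_of_isAcyclic (G := fromEdgeSet (B : Set (Sym2 V))) hF hS
    (by simpa only [hadj] using hdeg)
  have hle : fromEdgeSet (B : Set (Sym2 V)) ≤ G := fun u v h => hBG ((hadj u v).1 h)
  refine ⟨(Copy.ofLE _ _ hle).comp φ, ?_⟩
  have hmem : ∀ e ∈ F.edgeSet, e.map φ ∈ B := by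
    intro e
    induction e using Sym2.ind with
    | _ u v => exact fun h => (hadj _ _).1 (φ.toHom.map_adj h)
  intro e he e' he' hne
  exact hind _ (hmem e he) _ (hmem e' he') fun h => hne (Sym2.map.injective φ.injective h)

/-- Balls in graphs of bounded degree are bounded. -/
theorem exists_finset_ball {V : Type*} [Fintype V] {G : SimpleGraph V} {D : ℕ}
    [DecidableRel G.Adj] (hD : ∀ v, G.degree v ≤ D) (u : V) (N : ℕ) :
    ∃ B : Finset V, B.card ≤ (D + 1) ^ N ∧ ∀ v, ∀ p : G.Walk u v, p.length ≤ N → v ∈ B := by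
  classical
  induction N with
  | zero =>
    refine ⟨{u}, by simp, fun v p hp => ?_⟩
    rw [Walk.eq_of_length_eq_zero (Nat.le_zero.1 hp), Finset.mem_singleton]
  | succ N ih =>
    obtain ⟨B, hB, hwalk⟩ := ih
    refine ⟨B.biUnion fun w => insert w (G.neighborFinset w), ?_, fun v p hp => ?_⟩
    · refine (Finset.card_biUnion_le_card_mul _ _ (D + 1) fun w _ => ?_).trans ?_
      · refine (Finset.card_insert_le _ _).trans ?_
        simpa using hD w
      · rw [pow_succ]
        exact Nat.mul_le_mul_right _ hB
    · rw [Finset.mem_biUnion]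
      by_cases hpN : p.length ≤ N
      · exact ⟨v, hwalk v p hpN, by simp⟩
      · have hnil : ¬ p.Nil := fun h => hpN (by simp [Walk.length_eq_zero_iff.2 h])
        refine ⟨p.penultimate, hwalk _ p.dropLast (by simp; omega), ?_⟩
        simpa using Or.inr (p.adj_penultimate hnil)

/-- There are graphs with many edges all of whose small subgraphs are acyclic. -/
theorem exists_locally_acyclic (N d : ℕ) : ∃ (n : ℕ) (G : SimpleGraph (Fin n)) (_ : DecidableRel G.Adj),
    0 < n ∧ d * n ≤ G.edgeFinset.card ∧
      ∀ S : Finset (Fin n), S.card ≤ N → (G.induce (S : Set (Fin n))).IsAcyclic := by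
  classical
  set D := 4 * d with hD
  set n := 2 * (D + 1) ^ (N + 1) with hn
  have hpos : 0 < n := by positivity
  -- Take `G` maximal with degrees at most `D` and all induced subgraphs on at most `N` vertices
  -- acyclic.
  obtain ⟨G, hG⟩ := (Set.toFinite {G : SimpleGraph (Fin n) | (∀ v, G.degree v ≤ D) ∧
    ∀ S : Finset (Fin n), S.card ≤ N → (G.induce (S : Set (Fin n))).IsAcyclic}).exists_maximal
      ⟨⊥, by
        refine ⟨by simp, fun S _ => ?_⟩
        exact isAcyclic_bot.induce _⟩
  obtain ⟨hdeg, hac⟩ := hG.prop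
  refine ⟨n, G, inferInstance, hpos, ?_, hac⟩
  -- Two vertices of degree below `D` at distance more than `N + 1` could be joined: a new cycle on
  -- at most `N` vertices would contain a short path between them. So all such vertices lie in one
  -- ball, of at most `n / 2` vertices by the choice of `n`, and the others have degree `D = 4d`.
  have hlow : (Finset.univ.filter fun v => G.degree v < D).card ≤ (D + 1) ^ (N + 1) := by
    rcases (Finset.univ.filter fun v => G.degree v < D).eq_empty_or_nonempty with h | ⟨u, hu⟩
    · simp [h]
    obtain ⟨B, hB, hball⟩ := exists_finset_ball hdeg u (N + 1)
    refine (Finset.card_le_card fun v hv => ?_).trans hB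
    rw [Finset.mem_filter] at hu hv
    by_contra hfar
    have huv : u ≠ v := by
      rintro rfl
      exact hfar (hball u Walk.nil (by simp))
    have hnadj : ¬ G.Adj u v := fun h => hfar (hball v h.toWalk (by simp))
    have hnew : (G ⊔ edge u v).Adj u v := by simp [edge_adj, huv]
    refine hnadj (hG.le_of_ge (y := G ⊔ edge u v) ⟨fun w => ?_, fun S hS => ?_⟩ le_sup_left hnew)
    · rw [← card_neighborFinset_eq_degree]
      by_cases hw : w = u
      · subst hw
        refine (Finset.card_le_card (t := insert v (G.neighborFinset w)) fun x hx => ?_).trans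
          ((Finset.card_insert_le _ _).trans ?_)
        · simp only [mem_neighborFinset, sup_adj, edge_adj, Finset.mem_insert] at hx ⊢
          grind
        · rw [card_neighborFinset_eq_degree]
          omega
      · by_cases hw' : w = v
        · subst hw'
          refine (Finset.card_le_card (t := insert u (G.neighborFinset w)) fun x hx => ?_).trans
            ((Finset.card_insert_le _ _).trans ?_)
          · simp only [mem_neighborFinset, sup_adj, edge_adj, Finset.mem_insert] at hx ⊢
            grind
          · rw [card_neighborFinset_eq_degree]
            omega
        · refine (Finset.card_le_card (t := G.neighborFinset w) fun x hx => ?_).trans ?_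
          · simp only [mem_neighborFinset, sup_adj, edge_adj] at hx ⊢
            grind
          · rw [card_neighborFinset_eq_degree]
            exact hdeg w
    · by_cases huvS : u ∈ S ∧ v ∈ S
      · obtain ⟨huS, hvS⟩ := huvS
        have hnr : ¬ (G.induce (S : Set (Fin n))).Reachable ⟨u, huS⟩ ⟨v, hvS⟩ := by
          rintro ⟨p⟩
          have h1 : p.bypass.length < Fintype.card (S : Set (Fin n)) := p.bypass_isPath.length_lt
          refine hfar (hball v (p.bypass.map (Embedding.induce (S : Set (Fin n))).toHom) ?_)
          refine (Walk.length_map _ _).le.trans ?_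
          simp at h1
          omega
        refine ((hac S hS).sup_edge_of_not_reachable hnr).anti ?_
        rintro ⟨a, ha⟩ ⟨b, hb⟩ hab
        simp only [comap_adj, Function.Embedding.subtype_apply, sup_adj, edge_adj,
          Subtype.mk.injEq, ne_eq] at hab ⊢
        exact hab
      · refine (hac S hS).anti ?_
        rintro ⟨a, ha⟩ ⟨b, hb⟩ hab
        simp only [comap_adj, Function.Embedding.subtype_apply, sup_adj, edge_adj] at hab ⊢
        rcases hab with hab | ⟨⟨rfl, rfl⟩ | ⟨rfl, rfl⟩, -⟩
        · exact hab
        · exact absurd ⟨ha, hb⟩ huvS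
        · exact absurd ⟨hb, ha⟩ huvS
  have hsum := G.sum_degrees_eq_twice_card_edges
  have h1 : (Finset.univ.filter fun v => ¬ G.degree v < D).card * D ≤ ∑ v, G.degree v := by
    refine (Finset.card_nsmul_le_sum (Finset.univ.filter fun v => ¬ G.degree v < D)
      (fun v => G.degree v) D fun v hv => ?_).trans (Finset.sum_le_sum_of_subset (Finset.filter_subset _ _))
    simpa using hv
  have h2 := Finset.card_filter_add_card_filter_not (s := (Finset.univ : Finset (Fin n)))
    fun v => G.degree v < D
  rw [Finset.card_univ, Fintype.card_fin] at h2
  have h3 : (D + 1) ^ (N + 1) * D ≤ (Finset.univ.filter fun v => ¬ G.degree v < D).card * D :=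
    Nat.mul_le_mul_right _ (by omega)
  have h4 : 2 * (d * n) = (D + 1) ^ (N + 1) * D := by
    rw [hn, hD]
    ring
  omega

/-- `𝓜(F)` is infinite for forests containing a path with three edges. -/
theorem infinite_minimalUnavoidableGraphs_of_path {W : Type*} [Finite W] {F : SimpleGraph W}
    (hF : F.IsAcyclic) {a b c d : W} (hab : F.Adj a b) (hbc : F.Adj b c)
    (hcd : F.Adj c d) (hac : a ≠ c) (hbd : b ≠ d) : (minimalUnavoidableGraphs F).Infinite := by
  classical
  have := Fintype.ofFinite W
  refine infinite_minimalUnavoidableGraphs fun N => ?_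
  obtain ⟨n, G, _, hn, hcard, hloc⟩ := exists_locally_acyclic N (3 * Fintype.card W)
  have : Nonempty (Fin n) := ⟨⟨0, hn⟩⟩
  refine ⟨Fin n, inferInstance, G, unavoidable_of_card_edgeFinset hF (by simpa using hcard), ?_⟩
  rintro m hm K ⟨ψ⟩
  refine not_unavoidable_of_isAcyclic ?_ hab hbc hcd hac hbd
  have hS : (Finset.univ.image ψ).card ≤ N := Finset.card_image_le.trans (by simpa using hm)
  refine (hloc _ hS).comap ⟨fun x => ⟨ψ x, by simp⟩, fun h => ψ.toHom.map_adj h⟩ ?_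
  intro x y h
  exact ψ.injective (congrArg Subtype.val h)

/-! ### Star forests and suns. -/

/-- If the degrees in `U` are large compared with the number of edges meeting `U`, then some vertex of
`U` is the centre of a free star with more than `q` edges. -/
theorem exists_free_star {V : Type*} [Fintype V] [DecidableEq V] {G : SimpleGraph V}
    [DecidableRel G.Adj] (g : Sym2 V → Sym2 V) (U : Finset V) (A : Finset (Sym2 V)) (q : ℕ)
    (hA : ∀ v ∈ U, G.incidenceFinset v ⊆ A)
    (hcard : A.card + 3 * q * U.card < 2 * ∑ v ∈ U, (G.incidenceFinset v).card) :
    ∃ v ∈ U, ∃ B ⊆ G.incidenceFinset v, B.card = q + 1 ∧ ∀ x ∈ B, ∀ y ∈ B, x ≠ y → g x ≠ y := by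
  by_contra! hcon
  let I := fun v => G.incidenceFinset v
  let J := fun v => (I v).filter fun x => g x ∈ I v ∧ g x ≠ x
  have hstar : ∀ v ∈ U, 2 * (I v).card ≤ 3 * q + (J v).card := by
    intro v hv
    obtain ⟨B, hB, hind, hle⟩ := exists_independent_subset g (I v)
    have hq : B.card ≤ q := by
      by_contra! hlt
      obtain ⟨C, hC, hCq⟩ := Finset.exists_subset_card_eq (n := q + 1) hlt
      obtain ⟨x, hx, y, hy, hxy, h⟩ := hcon v hv C (hC.trans hB) hCq
      exact hind x (hC hx) y (hC hy) hxy h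
    have hle' : 2 * (I v).card ≤ 3 * B.card + (J v).card := hle
    omega
  -- Distinct edges `e` and `g e` share at most one vertex, so `e` is counted in `J v` for at most
  -- one `v`.
  have hsum : ∑ v ∈ U, (J v).card ≤ A.card := by
    rw [← Finset.card_biUnion]
    · refine Finset.card_le_card (Finset.biUnion_subset.2 fun v hv => ?_)
      exact (Finset.filter_subset _ _).trans (hA v hv)
    · intro v _ w _ hvw
      refine Finset.disjoint_left.2 fun e hev hew => ?_
      simp only [J, I, Finset.mem_filter, mem_incidenceFinset, incidenceSet, Set.mem_ofPred_eq]
        at hev hew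
      have h1 := (Sym2.mem_and_mem_iff hvw).1 ⟨hev.1.2, hew.1.2⟩
      have h2 := (Sym2.mem_and_mem_iff hvw).1 ⟨hev.2.1.2, hew.2.1.2⟩
      exact hev.2.2 (h2.trans h1.symm)
  have h1 := Finset.sum_le_sum hstar
  rw [Finset.sum_add_distrib, Finset.sum_const, smul_eq_mul, ← Finset.mul_sum] at h1
  have h2 : U.card * (3 * q) = 3 * q * U.card := mul_comm _ _
  simp only [I] at h1
  omega

/-- In a star forest every vertex can be assigned a centre. -/
theorem exists_center {W : Type*} [Finite W] {F : SimpleGraph W}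
    (hF : ∀ u v, F.Adj u v → (∀ w, F.Adj u w → w = v) ∨ ∀ w, F.Adj v w → w = u) :
    ∃ γ : W → W, ∀ u v, F.Adj u v → (γ u = v ∧ γ v = v) ∨ (γ v = u ∧ γ u = u) := by
  classical
  obtain ⟨n, ⟨o⟩⟩ := Finite.exists_equiv_fin W
  -- `P w v` says that `w` is a leaf with centre `v`. In a component `K₂` the order `o` decides: the
  -- larger end is the leaf.
  let P : W → W → Prop := fun w v =>
    F.Adj w v ∧ (∀ x, F.Adj w x → x = v) ∧ ((∃ x, F.Adj v x ∧ x ≠ w) ∨ o v < o w)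
  let γ : W → W := fun w => if h : ∃ v, P w v then h.choose else w
  have hpos : ∀ {w v}, P w v → γ w = v := by
    intro w v h
    have hex : ∃ v, P w v := ⟨v, h⟩
    exact (dif_pos hex).trans (h.2.1 _ hex.choose_spec.1)
  have hneg : ∀ {w}, (∀ v, ¬ P w v) → γ w = w := by
    intro w h
    exact dif_neg fun ⟨v, hv⟩ => h v hv
  have key : ∀ u v, F.Adj u v → (∀ w, F.Adj u w → w = v) →
      (γ u = v ∧ γ v = v) ∨ (γ v = u ∧ γ u = u) := by
    intro u v huv hu
    by_cases hv : ∃ x, F.Adj v x ∧ x ≠ u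
    · refine Or.inl ⟨hpos ⟨huv, hu, Or.inl hv⟩, hneg fun z hz => ?_⟩
      obtain ⟨x, hx, hxu⟩ := hv
      exact hxu ((hz.2.1 x hx).trans (hz.2.1 u huv.symm).symm)
    · push Not at hv
      have hno : o u ≠ o v := fun h => huv.ne (o.injective h)
      rcases lt_or_gt_of_ne hno with h | h
      · refine Or.inr ⟨hpos ⟨huv.symm, hv, Or.inr h⟩, hneg fun z hz => ?_⟩
        obtain rfl := hu z hz.1
        rcases hz.2.2 with ⟨x, hx, hxu⟩ | hlt
        · exact hxu (hv x hx)
        · exact absurd hlt h.not_gt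
      · refine Or.inl ⟨hpos ⟨huv, hu, Or.inr h⟩, hneg fun z hz => ?_⟩
        obtain rfl := hv z hz.1
        rcases hz.2.2 with ⟨x, hx, hxu⟩ | hlt
        · exact hxu (hu x hx)
        · exact absurd hlt h.not_gt
  refine ⟨γ, fun u v huv => ?_⟩
  rcases hF u v huv with h | h
  · exact key u v huv h
  · exact (key v u huv.symm h).symm

/-- A star forest embeds into a family of disjoint large stars. -/
theorem exists_copy_of_stars {V W J : Type*} [Fintype W] {F : SimpleGraph W} [DecidableRel F.Adj]
    {G : SimpleGraph V}
    (hF : ∀ u v, F.Adj u v → (∀ w, F.Adj u w → w = v) ∨ ∀ w, F.Adj v w → w = u)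
    (z : W → V) (B : W → Finset (Sym2 V)) (idx : V → J) (ι : W → J) (hι : Function.Injective ι)
    (hBG : ∀ w, ∀ e ∈ B w, e ∈ G.incidenceSet (z w)) (hBi : ∀ w, ∀ e ∈ B w, ∀ x ∈ e, idx x = ι w)
    (hz : ∀ w, idx (z w) = ι w) (hB : ∀ w, F.degree w ≤ (B w).card) :
    ∃ φ : Copy F G, ∀ e ∈ F.edgeSet, ∃ w, e.map φ ∈ B w := by
  classical
  obtain ⟨γ, hγ⟩ := exists_center hF
  have hleaf : ∀ w, ∃ o : F.neighborFinset w → V, Function.Injective o ∧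
      ∀ x, s(z w, o x) ∈ B w := by
    intro w
    obtain ⟨k⟩ := Function.Embedding.nonempty_of_card_le (α := F.neighborFinset w) (β := B w)
      (by rw [Fintype.card_coe, Fintype.card_coe, card_neighborFinset_eq_degree]; exact hB w)
    have hk : ∀ x, ∃ y, (k x : Sym2 V) = s(z w, y) := fun x =>
      Sym2.mem_iff_exists.1 (hBG w _ (k x).2).2
    choose o ho using hk
    refine ⟨o, fun a b hab => ?_, fun x => by rw [← ho]; exact (k x).2⟩
    apply k.injective
    apply Subtype.ext
    rw [ho, ho, hab]
  choose o hoi hoB using hleaf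
  have hoz : ∀ w x, o w x ≠ z w := by
    intro w x h
    have := (hBG w _ (hoB w x)).1
    rw [h] at this
    exact G.loopless.irrefl _ this
  have hoidx : ∀ w x, idx (o w x) = ι w := fun w x => hBi w _ (hoB w x) _ (Sym2.mem_mk_right _ _)
  -- A leaf goes into the star reserved for its centre, any other vertex to the centre of its own
  -- star; `idx` keeps different stars disjoint.
  let φ : W → V := fun x => if h : F.Adj (γ x) x then o (γ x) ⟨x, by simpa using h⟩ else
    z x
  have hleafφ : ∀ {x w} (h : F.Adj w x), γ x = w → φ x = o w ⟨x, by simpa using h⟩ := by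
    rintro x _ h rfl
    exact dif_pos h
  have hcenφ : ∀ {x}, ¬ F.Adj (γ x) x → φ x = z x := fun h => dif_neg h
  have hedge : ∀ {u v}, F.Adj u v → ∃ w, s(φ u, φ v) ∈ B w := by
    have aux : ∀ {u v}, F.Adj u v → γ u = v → γ v = v → s(φ v, φ u) ∈ B v := by
      intro u v huv h1 h2
      rw [hleafφ huv.symm h1, hcenφ (by rw [h2]; exact F.loopless.irrefl v)]
      exact hoB _ _
    intro u v huv
    rcases hγ u v huv with h | h
    · refine ⟨v, ?_⟩
      rw [Sym2.eq_swap]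
      exact aux huv h.1 h.2
    · exact ⟨u, aux huv.symm h.1 h.2⟩
  have hcen : ∀ {x}, ¬ F.Adj (γ x) x → ∀ {y}, F.Adj (γ y) y → φ x ≠ φ y := by
    intro x hx y hy h
    rw [hcenφ hx, hleafφ hy rfl] at h
    have h1 : x = γ y := hι (by rw [← hz, h, hoidx])
    subst h1
    exact hoz _ _ h.symm
  refine ⟨⟨⟨φ, ?_⟩, ?_⟩, ?_⟩
  · intro u v huv
    obtain ⟨w, hw⟩ := hedge huv
    exact (hBG w _ hw).1
  · intro x y hxy
    change φ x = φ y at hxy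
    by_cases hx : F.Adj (γ x) x <;> by_cases hy : F.Adj (γ y) y
    · rw [hleafφ hx rfl] at hxy
      have hg : γ y = γ x := hι (by
        rw [← hoidx (γ x) ⟨x, by simpa using hx⟩, hxy, hleafφ hy rfl, hoidx])
      rw [hleafφ (hg ▸ hy) hg] at hxy
      simpa using hoi _ hxy
    · exact absurd hxy.symm (hcen hy hx)
    · exact absurd hxy (hcen hx hy)
    · rw [hcenφ hx, hcenφ hy] at hxy
      exact hι (by rw [← hz, hxy, hz])
  · intro e
    induction e using Sym2.ind with
    | _ u v => exact fun h => hedge h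

/-- The vertices of a cycle of length `l + 3` with `3 s` pendant vertices at every vertex of the cycle
and one additional pendant vertex. -/
abbrev SunVertex (s l : ℕ) : Type := Fin (l + 3) ⊕ Option (Fin (l + 3) × Fin s × Fin 3)

/-- The cyclic successor. -/
def cycleNext {l : ℕ} (i : Fin (l + 3)) : Fin (l + 3) :=
  if h : i.val + 1 < l + 3 then ⟨i.val + 1, h⟩ else 0

theorem cycleNext_val {l : ℕ} (i : Fin (l + 3)) :
    (cycleNext i).val = if i.val + 1 < l + 3 then i.val + 1 else 0 := by
  unfold cycleNext
  split_ifs <;> rfl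

/-- The vertex of the cycle that a vertex is joined to: the successor for a vertex of the cycle, the
point of attachment for a pendant vertex. -/
def sunRoot {s l : ℕ} : SunVertex s l → Fin (l + 3)
  | Sum.inl i => cycleNext i
  | Sum.inr none => 0
  | Sum.inr (some (i, _)) => i

theorem sunRoot_ne {s l : ℕ} (x : SunVertex s l) : Sum.inl (sunRoot x) ≠ x := by
  rcases x with i | x
  · intro h
    have h1 : cycleNext i = i := Sum.inl_injective h
    have h2 := congrArg Fin.val h1
    rw [cycleNext_val] at h2
    split_ifs at h2 <;> omega
  · simp

/-- Here the cycle length must be at least 3. This makes `sunEdge` injective. -/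
theorem sunRoot_sunRoot_ne {s l : ℕ} (x : SunVertex s l) :
    Sum.inl (sunRoot (Sum.inl (sunRoot x) : SunVertex s l)) ≠ x := by
  rcases x with i | x
  · intro h
    have h1 : cycleNext (cycleNext i) = i := Sum.inl_injective h
    have h2 := congrArg Fin.val h1
    rw [cycleNext_val, cycleNext_val] at h2
    split_ifs at h2 <;> omega
  · simp

/-- The disjoint union of `M` cycles of length `l + 3`, with `3 s` pendant edges at every vertex of
the cycles and one additional pendant edge in every component. -/
def sunGraph (M s l : ℕ) : SimpleGraph (Fin M × SunVertex s l) where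
  Adj x y := x.1 = y.1 ∧ (Sum.inl (sunRoot x.2) = y.2 ∨ Sum.inl (sunRoot y.2) = x.2)
  symm := ⟨fun _ _ h => ⟨h.1.symm, h.2.symm⟩⟩
  loopless := ⟨fun x h => h.2.elim (sunRoot_ne x.2) (sunRoot_ne x.2)⟩

/-- The edge of `sunGraph` joining a vertex to its root. -/
def sunEdge {M s l : ℕ} (x : Fin M × SunVertex s l) : Sym2 (Fin M × SunVertex s l) :=
  s(x, (x.1, Sum.inl (sunRoot x.2)))

theorem sunEdge_mem {M s l : ℕ} (x : Fin M × SunVertex s l) :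
    sunEdge x ∈ (sunGraph M s l).edgeSet :=
  ⟨rfl, Or.inl rfl⟩

theorem sunEdge_injective {M s l : ℕ} :
    Function.Injective (sunEdge : Fin M × SunVertex s l → Sym2 (Fin M × SunVertex s l)) := by
  intro x y h
  rcases Sym2.eq_iff.1 h with h | ⟨h1, h2⟩
  · exact h.1
  · exfalso
    rw [h1] at h2
    exact sunRoot_sunRoot_ne y.2 (congrArg Prod.snd h2)

/-- Hence the vertices label the edges bijectively, and an edge map can be given as a map of
vertices. -/
theorem exists_sunEdge {M s l : ℕ} {e : Sym2 (Fin M × SunVertex s l)}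
    (he : e ∈ (sunGraph M s l).edgeSet) : ∃ x, sunEdge x = e := by
  induction e using Sym2.ind with
  | _ x y =>
    obtain ⟨h1, h2 | h2⟩ := he
    · refine ⟨x, ?_⟩
      rw [sunEdge, h2, h1]
    · refine ⟨y, ?_⟩
      rw [sunEdge, h2, ← h1, Sym2.eq_swap]

theorem fst_eq_of_mem_edge {M s l : ℕ} {e : Sym2 (Fin M × SunVertex s l)}
    (he : e ∈ (sunGraph M s l).edgeSet) {x y : Fin M × SunVertex s l} (hx : x ∈ e) (hy : y ∈ e) :
    x.1 = y.1 := by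
  obtain ⟨w, rfl⟩ := exists_sunEdge he
  simp only [sunEdge, Sym2.mem_iff] at hx hy
  rcases hx with rfl | rfl <;> rcases hy with rfl | rfl <;> rfl

/-- Every component of `sunGraph` contains a free star with `s + 2` edges. -/
theorem sunGraph_exists_free_star {M s l : ℕ}
    (g : Sym2 (Fin M × SunVertex s l) → Sym2 (Fin M × SunVertex s l)) (c : Fin M) :
    ∃ i : Fin (l + 3), ∃ B : Finset (Sym2 (Fin M × SunVertex s l)),
      (∀ e ∈ B, e ∈ (sunGraph M s l).incidenceSet (c, Sum.inl i)) ∧ B.card = s + 2 ∧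
        ∀ x ∈ B, ∀ y ∈ B, x ≠ y → g x ≠ y := by
  classical
  let U : Finset (Fin M × SunVertex s l) := Finset.univ.image fun i => (c, Sum.inl i)
  let A : Finset (Sym2 (Fin M × SunVertex s l)) := Finset.univ.image fun x => sunEdge (c, x)
  have hU : U.card = l + 3 := by
    rw [Finset.card_image_of_injective, Finset.card_univ, Fintype.card_fin]
    intro a b h
    simpa using h
  have hV : Fintype.card (SunVertex s l) = (l + 3) + ((l + 3) * (s * 3) + 1) := by simp
  have hA : A.card ≤ (l + 3) + ((l + 3) * (s * 3) + 1) := by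
    rw [← hV, ← Finset.card_univ]
    exact Finset.card_image_le
  have hsum : (l + 3) + ((l + 3) * (s * 3) + 1) + (l + 3) ≤
      ∑ v ∈ U, ((sunGraph M s l).incidenceFinset v).card := by
    rw [← Finset.card_sigma]
    -- Every edge is counted at its root, and the edges of the cycle once more at their other end.
    let j : SunVertex s l ⊕ Fin (l + 3) →
        (_ : Fin M × SunVertex s l) × Sym2 (Fin M × SunVertex s l) :=
      Sum.elim (fun x => ⟨(c, Sum.inl (sunRoot x)), sunEdge (c, x)⟩)
        fun i => ⟨(c, Sum.inl i), sunEdge (c, Sum.inl i)⟩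
    have hj : Function.Injective j := by
      rintro (x | x) (y | y) h
      · have := sunEdge_injective (congrArg Sigma.snd h)
        simpa using this
      · have h1 : (c, x) = (c, Sum.inl y) := sunEdge_injective (congrArg Sigma.snd h)
        have h2 : ((c, Sum.inl (sunRoot x)) : Fin M × SunVertex s l) = (c, Sum.inl y) :=
          congrArg Sigma.fst h
        exact absurd (congrArg Prod.snd (h2.trans h1.symm)) (sunRoot_ne x)
      · have h1 : (c, Sum.inl x) = (c, y) := sunEdge_injective (congrArg Sigma.snd h)
        have h2 : ((c, Sum.inl x) : Fin M × SunVertex s l) = (c, Sum.inl (sunRoot y)) :=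
          congrArg Sigma.fst h
        exact absurd (congrArg Prod.snd (h2.symm.trans h1)) (sunRoot_ne y)
      · have := sunEdge_injective (congrArg Sigma.snd h)
        simpa using this
    have hcard : (Finset.univ.image j).card = (l + 3) + ((l + 3) * (s * 3) + 1) + (l + 3) := by
      rw [Finset.card_image_of_injective _ hj, Finset.card_univ, Fintype.card_sum, hV,
        Fintype.card_fin]
    rw [← hcard]
    refine Finset.card_le_card fun y hy => ?_
    obtain ⟨x, -, rfl⟩ := Finset.mem_image.1 hy
    rw [Finset.mem_sigma]
    rcases x with x | i
    · refine ⟨Finset.mem_image.2 ⟨_, Finset.mem_univ _, rfl⟩, ?_⟩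
      exact (mem_incidenceFinset _ _ _).2 ⟨sunEdge_mem _, Sym2.mem_mk_right _ _⟩
    · refine ⟨Finset.mem_image.2 ⟨_, Finset.mem_univ _, rfl⟩, ?_⟩
      exact (mem_incidenceFinset _ _ _).2 ⟨sunEdge_mem _, Sym2.mem_mk_left _ _⟩
  obtain ⟨v, hv, B, hB, hBc, hind⟩ := exists_free_star (G := sunGraph M s l) g U A (s + 1) (by
    intro v hv e he
    obtain ⟨i, -, rfl⟩ := Finset.mem_image.1 hv
    rw [mem_incidenceFinset] at he
    obtain ⟨⟨d, x⟩, rfl⟩ := exists_sunEdge he.1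
    have : d = c := fst_eq_of_mem_edge he.1 (Sym2.mem_mk_left _ _) he.2
    subst this
    exact Finset.mem_image.2 ⟨x, Finset.mem_univ _, rfl⟩) (by
      -- The bounds on the two sides differ by exactly 1, which is the contribution of the
      -- additional pendant edge.
      rw [hU]
      nlinarith)
  obtain ⟨i, -, rfl⟩ := Finset.mem_image.1 hv
  exact ⟨i, B, fun e he => (mem_incidenceFinset _ _ _).1 (hB he), hBc, hind⟩

/-- Sufficiently many suns are unavoidable for a star forest. -/
theorem unavoidable_sunGraph {W : Type*} [Fintype W] {F : SimpleGraph W} [DecidableRel F.Adj]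
    (hF : ∀ u v, F.Adj u v → (∀ w, F.Adj u w → w = v) ∨ ∀ w, F.Adj v w → w = u)
    {s : ℕ} (hs : ∀ v, F.degree v ≤ s + 2) (l : ℕ) :
    Unavoidable (sunGraph ((2 * (s + 2) + 1) * Fintype.card W) s l) F := by
  classical
  set M := (2 * (s + 2) + 1) * Fintype.card W with hM
  refine unavoidable_iff.2 fun g => ?_
  choose i B hBG hBc hind using sunGraph_exists_free_star (M := M) g
  have hidx : ∀ c, ∀ e ∈ B c, ∀ x ∈ e, x.1 = c := fun c e he x hx =>
    fst_eq_of_mem_edge (hBG c e he).1 hx (hBG c e he).2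
  -- The chosen star of a component has `s + 2` edges, so its images meet at most `s + 2`
  -- components. This yields `|W|` components whose stars do not interfere.
  obtain ⟨D, -, hDc, hD⟩ := exists_independent_of_outDegree_le
    (fun c c' => ∃ e ∈ B c, g e ∈ B c') (s + 2) Finset.univ (fun c _ => by
      refine ⟨(B c).image fun e => (g e).out.1.1, Finset.card_image_le.trans (hBc c).le, ?_⟩
      rintro c' - ⟨e, he, hge⟩
      exact Finset.mem_image.2 ⟨e, he, hidx c' _ hge _ (Sym2.out_fst_mem _)⟩)
    (Fintype.card W) (by simp [hM])
  obtain ⟨ι⟩ := Function.Embedding.nonempty_of_card_le (α := W) (β := D) (by simp [hDc])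
  obtain ⟨φ, hφ⟩ := exists_copy_of_stars (G := sunGraph M s l) hF
    (fun w => ((ι w : Fin M), Sum.inl (i (ι w)))) (fun w => B (ι w)) Prod.fst
    (fun w => (ι w : Fin M)) (Subtype.val_injective.comp ι.injective)
    (fun w => hBG _) (fun w => hidx _) (fun w => rfl) (fun w => by rw [hBc]; exact hs w)
  refine ⟨φ, fun e he e' he' hne hg => ?_⟩
  obtain ⟨w, hw⟩ := hφ e he
  obtain ⟨w', hw'⟩ := hφ e' he'
  by_cases hww : w = w'
  · subst hww
    exact hind _ _ hw _ hw' (fun h => hne (Sym2.map.injective φ.injective h)) hg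
  · refine hD _ (ι w).2 _ (ι w').2 (fun h => hww (ι.injective (Subtype.ext h))) ⟨_, hw, ?_⟩
    rw [hg]
    exact hw'

/-- The edge map of a sun with the cycle vertex `j` removed, in terms of the vertices labelling the
edges: triples of pendant edges are permuted cyclically, as are the additional pendant edge and the
two edges of the cycle next to it; the other edges of the cycle are shifted away from `j`. -/
def sunStep {s l : ℕ} (j : Fin (l + 3)) : SunVertex s l → SunVertex s l
  | Sum.inl i =>
    if i.val + 1 = l + 3 then Sum.inr none
    else if i.val = 0 then Sum.inl (Fin.last (l + 2))
    else if i < j then Sum.inl ⟨i.val - 1, by omega⟩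
    else Sum.inl (cycleNext i)
  | Sum.inr none => Sum.inl 0
  | Sum.inr (some (i, a, b)) => Sum.inr (some (i, a, b + 1))

/-- The triple of pendant edges that a pendant vertex belongs to, if any. -/
def sunGroup {s l : ℕ} : SunVertex s l → Option (Fin s)
  | Sum.inr (some (_, a, _)) => some a
  | _ => none

/-- The label of the edge joining a neighbour `y` of the cycle vertex `i` to `i`. -/
theorem exists_sunEdge_label {M s l : ℕ} {c : Fin M} {i : Fin (l + 3)} {v : Fin M × SunVertex s l}
    (h : (sunGraph M s l).Adj (c, Sum.inl i) v) : ∃ x, sunEdge (c, x) = s((c, Sum.inl i), v) ∧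
      ((x = v.2 ∧ sunRoot x = i) ∨ (x = Sum.inl i ∧ v.2 = Sum.inl (cycleNext i))) := by
  obtain ⟨d, y⟩ := v
  obtain ⟨h1, h2 | h2⟩ := h
  · dsimp only at h1 h2
    subst h1 h2
    exact ⟨Sum.inl i, rfl, Or.inr ⟨rfl, rfl⟩⟩
  · dsimp only at h1 h2
    subst h1
    refine ⟨y, ?_, Or.inl ⟨rfl, Sum.inl_injective h2⟩⟩
    rw [sunEdge, h2, Sym2.eq_swap]

/-- Two edges at a cycle vertex which belong to the same group are related by `sunStep`. -/
theorem sunStep_eq_or {s l : ℕ} {i j : Fin (l + 3)} {x x' y y' : SunVertex s l} (hij : i ≠ j)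
    (hj : y ≠ Sum.inl j) (hj' : y' ≠ Sum.inl j) (hyy : y ≠ y')
    (hg : sunGroup y = sunGroup y')
    (hx : (x = y ∧ sunRoot x = i) ∨ (x = Sum.inl i ∧ y = Sum.inl (cycleNext i)))
    (hx' : (x' = y' ∧ sunRoot x' = i) ∨ (x' = Sum.inl i ∧ y' = Sum.inl (cycleNext i))) :
    sunStep j x = x' ∨ sunStep j x' = x := by
  -- The two cycle edges at `i`: before `j` the later one is sent to the earlier one, after `j`
  -- conversely. At vertex 0 the wrap-around to the last edge serves.
  have hcyc : ∀ i' : Fin (l + 3), i' ≠ j → cycleNext i' = i →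
      sunStep j (Sum.inl i' : SunVertex s l) = Sum.inl i ∨
        sunStep j (Sum.inl i : SunVertex s l) = Sum.inl i' := by
    rintro i' hi' rfl
    have hv := cycleNext_val i'
    have h1 : i'.val ≠ j.val := fun h => hi' (Fin.ext h)
    have h2 : (cycleNext i').val ≠ j.val := fun h => hij (Fin.ext h)
    have h3 := i'.isLt
    have h4 := j.isLt
    by_cases hlast : i'.val + 1 < l + 3
    · rw [if_pos hlast] at hv
      by_cases hlt : i'.val < j.val
      · right
        have h5 : (cycleNext i') < j := by rw [Fin.lt_def]; omega
        simp only [sunStep]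
        rw [if_neg (by omega), if_neg (by omega), if_pos h5]
        exact congrArg Sum.inl (Fin.ext (by simp [hv]))
      · left
        have h5 : ¬ i' < j := by rw [Fin.lt_def]; omega
        simp only [sunStep]
        rw [if_neg (by omega), if_neg (by omega), if_neg h5]
    · rw [if_neg hlast] at hv
      right
      simp only [sunStep]
      rw [if_neg (by omega), if_pos hv]
      exact congrArg Sum.inl (Fin.ext (by simp; omega))
  have hlast : ∀ i' : Fin (l + 3), cycleNext i' = 0 →
      sunStep j (Sum.inl i' : SunVertex s l) = Sum.inr none := by
    intro i' h
    have hv := cycleNext_val i'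
    rw [h] at hv
    simp only [sunStep]
    split_ifs at hv ⊢ <;> simp_all <;> omega
  rcases hx with ⟨rfl, hx⟩ | ⟨rfl, rfl⟩ <;> rcases hx' with ⟨rfl, hx'⟩ | ⟨rfl, rfl⟩
  · rcases x with a | _ | ⟨a, b, t⟩ <;> rcases x' with a' | _ | ⟨a', b', t'⟩ <;>
      simp only [sunRoot, sunGroup, reduceCtorEq, Option.some.injEq] at hx hx' hg
    · exfalso
      have h1 := cycleNext_val a
      have h2 := cycleNext_val a'
      rw [hx] at h1
      rw [hx'] at h2
      apply hyy
      refine congrArg Sum.inl (Fin.ext ?_)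
      split_ifs at h1 h2 <;> omega
    · left
      exact hlast a (hx.trans hx'.symm)
    · right
      exact hlast a' (hx'.trans hx.symm)
    · exact absurd rfl hyy
    · subst hx hx' hg
      have ht : t ≠ t' := by
        rintro rfl
        exact hyy rfl
      -- Distinct elements of `ℤ/3` differ by 1 in one direction; this is why pendant edges come in
      -- triples.
      have : t + 1 = t' ∨ t' + 1 = t := by
        clear hj hj' hyy
        decide +revert
      simpa [sunStep] using this
  · rcases x with a | _ | ⟨a, b, t⟩ <;> simp only [sunRoot, sunGroup, reduceCtorEq] at hx hg
    · exact hcyc a (fun h => hj (by rw [h])) hx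
    · left
      simp [sunStep, hx]
  · rcases x' with a | _ | ⟨a, b, t⟩ <;> simp only [sunRoot, sunGroup, reduceCtorEq] at hx' hg
    · exact (hcyc a (fun h => hj' (by rw [h])) hx').symm
    · right
      simp [sunStep, hx']
  · exact absurd rfl hyy

/-- A vertex of a sun with two neighbours lies on the cycle. -/
theorem exists_eq_inl_of_adj {M s l : ℕ} {u v w : Fin M × SunVertex s l}
    (hv : (sunGraph M s l).Adj u v) (hw : (sunGraph M s l).Adj u w) (hvw : v ≠ w) :
    ∃ i, u.2 = Sum.inl i := by
  rcases hv.2 with h | h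
  · rcases hw.2 with h' | h'
    · exact absurd (Prod.ext (hv.1.symm.trans hw.1) (h.symm.trans h')) hvw
    · exact ⟨_, h'.symm⟩
  · exact ⟨_, h.symm⟩

/-- Subgraphs of suns with fewer vertices than the cycles are avoidable for graphs with a vertex of
degree at least `s + 2`. -/
theorem not_unavoidable_of_isContained_sunGraph {M s l n : ℕ} {W : Type*} [Fintype W]
    {F : SimpleGraph W} [DecidableRel F.Adj] {v₀ : W} (hv₀ : s + 2 ≤ F.degree v₀)
    {K : SimpleGraph (Fin n)} (hn : n < l + 3) (hK : K ⊑ sunGraph M s l) : ¬ Unavoidable K F := by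
  classical
  intro hU
  obtain ⟨ψ⟩ := hK
  -- A subgraph with fewer vertices than a cycle misses a vertex of every cycle.
  have hmiss : ∀ c : Fin M, ∃ j : Fin (l + 3), ∀ x, ψ x ≠ (c, Sum.inl j) := by
    intro c
    by_contra! hcon
    choose k hk using hcon
    have hki : Function.Injective k := by
      intro a b hab
      have := (hk a).symm.trans ((congrArg ψ hab).trans (hk b))
      simpa using this
    have := Fintype.card_le_of_injective k hki
    simp at this
    omega
  choose j hj using hmiss
  obtain ⟨φ, hφ⟩ := hU.exists_copy ψ
    (Function.extend sunEdge (fun x => sunEdge (x.1, sunStep (j x.1) x.2)) id)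
  set χ := ψ.comp φ with hχ
  have hχj : ∀ x c, χ x ≠ (c, Sum.inl (j c)) := fun x c => hj c (φ x)
  have hadj : ∀ {x y}, F.Adj x y → (sunGraph M s l).Adj (χ x) (χ y) := fun h => χ.toHom.map_adj h
  obtain ⟨a, ha, b, hb, hab⟩ := Finset.one_lt_card.1
    (show 1 < (F.neighborFinset v₀).card by rw [card_neighborFinset_eq_degree]; omega)
  rw [mem_neighborFinset] at ha hb
  obtain ⟨i, hi⟩ := exists_eq_inl_of_adj (hadj ha) (hadj hb) fun h => hab (χ.injective h)
  obtain ⟨c, hc⟩ : ∃ c, χ v₀ = (c, Sum.inl i) := ⟨(χ v₀).1, Prod.ext rfl hi⟩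
  -- Pigeonhole: `s + 2` neighbours, but `s` triples and the group `none` of cycle neighbours and
  -- the additional pendant vertex.
  obtain ⟨w, hw, w', hw', hww, hgr⟩ := Finset.exists_ne_map_eq_of_card_lt_of_maps_to
    (s := F.neighborFinset v₀) (t := (Finset.univ : Finset (Option (Fin s))))
    (f := fun w => sunGroup (χ w).2)
    (by rw [card_neighborFinset_eq_degree]; simp; omega) (fun _ _ => Finset.mem_univ _)
  rw [mem_neighborFinset] at hw hw'
  have hadj₁ := hadj hw
  have hadj₂ := hadj hw'
  rw [hc] at hadj₁ hadj₂
  obtain ⟨x, hxe, hx⟩ := exists_sunEdge_label hadj₁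
  obtain ⟨x', hxe', hx'⟩ := exists_sunEdge_label hadj₂
  have hfst : ∀ {u}, (sunGraph M s l).Adj (c, Sum.inl i) u → u.1 = c := fun h => h.1.symm
  have hij : i ≠ j c := by
    rintro rfl
    exact hχj _ _ hc
  have hne : ∀ {u}, (sunGraph M s l).Adj (c, Sum.inl i) (χ u) → (χ u).2 ≠ Sum.inl (j c) :=
    fun h h' => hχj _ c (Prod.ext (hfst h) h')
  have hχne : (χ w).2 ≠ (χ w').2 := fun h =>
    hww (χ.injective (Prod.ext ((hfst hadj₁).trans (hfst hadj₂).symm) h))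
  have hmap : ∀ u, Sym2.map χ s(v₀, u) = s((c, Sum.inl i), χ u) := fun u => by
    rw [Sym2.map_mk, hc]
  have hedge : s(v₀, w) ≠ s(v₀, w') := fun h => hww (Sym2.congr_right.1 h)
  rcases sunStep_eq_or hij (hne hadj₁) (hne hadj₂) hχne hgr hx hx' with h | h
  · refine hφ s(v₀, w) hw s(v₀, w') hw' hedge ?_
    rw [hmap, hmap, ← hxe, ← hxe', sunEdge_injective.extend_apply]
    simp only [h]
  · refine hφ s(v₀, w') hw' s(v₀, w) hw hedge.symm ?_
    rw [hmap, hmap, ← hxe, ← hxe', sunEdge_injective.extend_apply]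
    simp only [h]

/-- `𝓜(F)` is infinite for star forests with a vertex of degree at least two. -/
theorem infinite_minimalUnavoidableGraphs_of_stars {W : Type*} [Finite W] {F : SimpleGraph W}
    (hF : ∀ u v, F.Adj u v → (∀ w, F.Adj u w → w = v) ∨ ∀ w, F.Adj v w → w = u)
    {v a b : W} (ha : F.Adj v a) (hb : F.Adj v b) (hab : a ≠ b) :
    (minimalUnavoidableGraphs F).Infinite := by
  classical
  have := Fintype.ofFinite W
  have : Nonempty W := ⟨v⟩
  obtain ⟨v₀, hv₀⟩ := F.exists_maximal_degree_vertex
  have h2 : 2 ≤ F.maxDegree := by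
    refine le_trans ?_ (F.degree_le_maxDegree v)
    rw [← card_neighborFinset_eq_degree]
    exact Finset.one_lt_card.2 ⟨a, by simpa using ha, b, by simpa using hb, hab⟩
  obtain ⟨s, hs⟩ := Nat.exists_eq_add_of_le' h2
  refine infinite_minimalUnavoidableGraphs fun N => ⟨_, inferInstance, _,
    unavoidable_sunGraph hF (s := s) (fun u => (F.degree_le_maxDegree u).trans hs.le) N, ?_⟩
  intro n hn K hK
  exact not_unavoidable_of_isContained_sunGraph (v₀ := v₀) (by omega) (by omega) hK

/-! ### Recognising matchings and the conclusion. -/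

/-- The graphs all of whose degrees are at most one are, up to isolated vertices, the matchings. -/
theorem exists_iso_matchingGraph_iff {W : Type*} [Finite W] {F : SimpleGraph W} :
    (∃ t, Nonempty (F.induce F.support ≃g matchingGraph t)) ↔
      ∀ v a b, F.Adj v a → F.Adj v b → a = b := by
  classical
  constructor
  · rintro ⟨t, ⟨i⟩⟩ v a b ha hb
    have hv : v ∈ F.support := ⟨a, ha⟩
    have ha' : a ∈ F.support := ⟨v, ha.symm⟩
    have hb' : b ∈ F.support := ⟨v, hb.symm⟩
    have h1 : (matchingGraph t).Adj (i ⟨v, hv⟩) (i ⟨a, ha'⟩) := i.map_adj_iff.2 ha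
    have h2 : (matchingGraph t).Adj (i ⟨v, hv⟩) (i ⟨b, hb'⟩) := i.map_adj_iff.2 hb
    have h3 : i ⟨a, ha'⟩ = i ⟨b, hb'⟩ :=
      Prod.ext (h1.1.symm.trans h2.1) (by have := h1.2; have := h2.2; omega)
    simpa using i.injective h3
  · intro h
    obtain ⟨t, ⟨ε⟩⟩ := Finite.exists_equiv_fin F.edgeSet
    obtain ⟨n, ⟨o⟩⟩ := Finite.exists_equiv_fin W
    refine ⟨t, ⟨?_⟩⟩
    have hnb : ∀ v : F.support, ∃ w, F.Adj v w := fun v => v.2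
    choose m hm using hnb
    -- A vertex is coded by its unique edge and by whether it is the smaller end of it for `o`.
    let E : F.support → F.edgeSet := fun v => ⟨s(v, m v), hm v⟩
    let side : F.support → Fin 2 := fun v => if o v < o (m v) then 0 else 1
    have hE : ∀ u v : F.support, E u = E v → u ≠ v → (v : W) = m u ∧ (u : W) = m v := by
      intro u v huv hne
      rcases Sym2.eq_iff.1 (congrArg Subtype.val huv) with h' | h'
      · exact absurd (Subtype.ext h'.1) hne
      · exact ⟨h'.2.symm, h'.1⟩
    have hside : ∀ u v : F.support, (v : W) = m u → (u : W) = m v → side u ≠ side v := by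
      intro u v h1 h2
      simp only [side]
      rw [← h1, ← h2]
      have : o (u : W) ≠ o (v : W) := fun h' => (hm u).ne ((o.injective h').trans h1)
      rcases lt_or_gt_of_ne this with h' | h'
      · simp [h', h'.not_gt]
      · simp [h', h'.not_gt]
    have hinj : Function.Injective fun v => (ε (E v), side v) := by
      intro u v huv
      by_contra hne
      simp only [Prod.mk.injEq, EmbeddingLike.apply_eq_iff_eq] at huv
      obtain ⟨h1, h2⟩ := hE u v huv.1 hne
      exact hside u v h1 h2 huv.2
    have hsurj : Function.Surjective fun v => (ε (E v), side v) := by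
      rintro ⟨k, p⟩
      obtain ⟨e, rfl⟩ := ε.surjective k
      obtain ⟨e, he⟩ := e
      induction e using Sym2.ind with
      | _ x y =>
        have hxy : F.Adj x y := he
        have hx : x ∈ F.support := ⟨y, hxy⟩
        have hy : y ∈ F.support := ⟨x, hxy.symm⟩
        have hmx : m ⟨x, hx⟩ = y := h x _ _ (hm ⟨x, hx⟩) hxy
        have hmy : m ⟨y, hy⟩ = x := h y _ _ (hm ⟨y, hy⟩) hxy.symm
        have hEx : E ⟨x, hx⟩ = ⟨s(x, y), he⟩ := Subtype.ext (by simp [E, hmx])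
        have hEy : E ⟨y, hy⟩ = ⟨s(x, y), he⟩ := Subtype.ext (by simp [E, hmy, Sym2.eq_swap])
        have hs := hside ⟨x, hx⟩ ⟨y, hy⟩ hmx.symm hmy.symm
        by_cases hp : side ⟨x, hx⟩ = p
        · exact ⟨⟨x, hx⟩, by simp [hEx, hp]⟩
        · exact ⟨⟨y, hy⟩, by simp only [hEy, Prod.mk.injEq, true_and]; omega⟩
    refine ⟨Equiv.ofBijective _ ⟨hinj, hsurj⟩, ?_⟩
    intro u v
    change (ε (E u) = ε (E v) ∧ side u ≠ side v) ↔ F.Adj u v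
    rw [EmbeddingLike.apply_eq_iff_eq]
    constructor
    · rintro ⟨h1, h2⟩
      have hne : u ≠ v := by
        rintro rfl
        exact h2 rfl
      rw [(hE u v h1 hne).1]
      exact hm u
    · intro huv
      have h1 : (v : W) = m u := h _ _ _ huv (hm u)
      have h2 : (u : W) = m v := h _ _ _ huv.symm (hm v)
      refine ⟨Subtype.ext ?_, hside u v h1 h2⟩
      simp only [E]
      rw [← h1, ← h2, Sym2.eq_swap]

/-- For a forest `F`, `𝓜(F)` is finite if and only if all degrees are at most one. -/
theorem finite_minimalUnavoidableGraphs_iff {W : Type*} [Finite W] {F : SimpleGraph W}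
    (hF : F.IsAcyclic) : (minimalUnavoidableGraphs F).Finite ↔
      ∃ t : ℕ, Nonempty (F.induce F.support ≃g matchingGraph t) := by
  constructor
  · intro hfin
    rw [exists_iso_matchingGraph_iff]
    by_contra! hcon
    obtain ⟨v, a, b, ha, hb, hab⟩ := hcon
    by_cases hstar : ∀ u v, F.Adj u v → (∀ w, F.Adj u w → w = v) ∨ ∀ w, F.Adj v w → w = u
    · exact infinite_minimalUnavoidableGraphs_of_stars hstar ha hb hab hfin
    -- An edge with a further neighbour at both ends is the middle of the required path.
    · push Not at hstar
      obtain ⟨x, y, hxy, ⟨p, hp, hpy⟩, q, hq, hqx⟩ := hstar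
      exact infinite_minimalUnavoidableGraphs_of_path hF hp.symm hxy hq hpy hqx.symm hfin
  · rintro ⟨t, ⟨i⟩⟩
    exact finite_minimalUnavoidableGraphs i

end EdgeMapping

theorem mainTheorem2 {V : Type*} [Finite V] (F : SimpleGraph V) (hF : F.IsAcyclic) :
    -- for forests without isolated vertices: `𝓜(F)` is finite iff `F = t K₂`
    ((∀ v, ∃ w, F.Adj v w) →
      ((EdgeMapping.minimalUnavoidableGraphs F).Finite ↔
        ∃ t : ℕ, Nonempty (F ≃g EdgeMapping.matchingGraph t))) ∧
    -- for all forests: `𝓜(F)` is finite iff `F`, with its isolated vertices removed, is `t K₂`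
    ((EdgeMapping.minimalUnavoidableGraphs F).Finite ↔
      ∃ t : ℕ, Nonempty (F.induce F.support ≃g EdgeMapping.matchingGraph t)) := by
  refine ⟨fun hiso => ?_, EdgeMapping.finite_minimalUnavoidableGraphs_iff hF⟩
  have hsupp : F.support = Set.univ := Set.eq_univ_of_forall fun v => hiso v
  have i : F.induce F.support ≃g F := by
    rw [hsupp]
    exact F.induceUnivIso
  rw [EdgeMapping.finite_minimalUnavoidableGraphs_iff hF]
  exact exists_congr fun t => ⟨fun ⟨j⟩ => ⟨i.symm.trans j⟩, fun ⟨j⟩ => ⟨i.trans j⟩⟩
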